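/- Let $\mathbb{D}=\{z\in\mathbb{C}:|z|\le 1\}$ be the closed unit disk, $z=\rho e^{i\omega}$, $x=1-\rho^2$, let $dV=\rho\,d\rho\,d\omega$ be Lebesgue measure, and let $\gamma\in\mathbb{R}$. Let $$\mathcal{L}_\gamma=-\rho^{-1}x^{-\gamma}\partial_\rho(\rho x^{\gamma+1}\partial_\rho)-\rho^{-2}\partial_\omega^2+(1+\gamma)^2=-x\Delta+(2+2\gamma)\rho\partial_\rho-\partial_\omega^2+(\gamma+1)^2,$$ and let $L^2_\gamma=L^2(\mathbb{D},x^\gamma dV)$ be the complex Hilbert space with inner product $(f,g)=\int_{\mathbb{D}}f\bar g\,x^\gamma dV$. Let $\dot C^\infty(\mathbb{D})$ be the space of complex-valued smooth functions on $\mathbb{D}$ all of whose derivatives (of all orders, including zero) vanish on $\partial\mathbb{D}$, and let $C_c^\infty(\mathbb{D}^{int})$ be the space of complex-valued smooth functions with compact support in the open disk. Suppose that $|\gamma|\ge 1$. Then $\dot C^\infty(\mathbb{D})$ and $\mathcal{L}_\gamma(\dot C^\infty(\mathbb{D}))$ are contained in $L^2_\gamma$, the operator $(\mathcal{L}_\gamma,\dot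 C^\infty(\mathbb{D}))$ in $L^2_\gamma$ is closable, and its closure, the minimal operator $\mathcal{L}_{\gamma,min}$, is self-adjoint. Moreover: (a) The operator $T=(\mathcal{L}_\gamma,C_c^\infty(\mathbb{D}^{int}))$ is densely defined, symmetric and nonnegative, and $\mathcal{L}_{\gamma,min}$ is equal to its Friedrichs extension $\mathcal{L}_{\gamma,D}$. Here, with $\alpha(u,v)=(Tu,v)$, let $V$ be the set of those $u\in L^2_\gamma$ for which there are $u_n\in C_c^\infty(\mathbb{D}^{int})$ with $u_n\to u$ in $L^2_\gamma$ and $\alpha(u_n-u_m,u_n-u_m)\to 0$ as $m,n\to\infty$, and let $\tilde\alpha$ be the extension of $\alpha$ to $V$ by continuity; then $u\in\mathrm{dom}(\mathcal{L}_{\gamma,D})$ and $\mathcal{L}_{\gamma,D}u=w$ if and only if $u\in V$ and $\tilde\alpha(u,v)=(w,v)$ for all $v\in V$. (b) $\mathcal{L}_{\gamma,min}$ is the only self-adjoint operator in $L^2_\gamma$ that extends $(\mathcal{L}_\gamma,\dot C^\infty(\mathbb{D}))$. -/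

import Mathlib

open Filter Topology MeasureTheory Metric
open scoped ContDiff InnerProductSpace

noncomputable section

namespace DiskOperator

/-! ### The differential expression on the unit disk

The plane is `ℂ`, regarded as a real vector space, with `z = ρ e^{iω}` and `x = 1 - ρ²`. -/

/-- The boundary defining function `x = 1 - ρ² = 1 - |z|²`. -/
def bdf (z : ℂ) : ℝ := 1 - ‖z‖ ^ 2

/-- The radial vector field `ρ ∂_ρ`, whose value at `z` is the vector `z`. -/
def radial (f : ℂ → ℂ) (z : ℂ) : ℂ := fderiv ℝ f z z

/-- The angular vector field `∂_ω`, whose value at `z` is the vector `i z`. -/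
def angular (f : ℂ → ℂ) (z : ℂ) : ℂ := fderiv ℝ f z (Complex.I * z)

/-- The operator `L_γ = -x Δ + (2 + 2γ) ρ ∂_ρ - ∂_ω² + (γ + 1)²`.
This is the smooth extension across the origin of
`-ρ⁻¹ x^{-γ} ∂_ρ (ρ x^{γ+1} ∂_ρ) - ρ⁻² ∂_ω² + (1 + γ)²`; see `diskOp_polar`. -/
def diskOp (γ : ℝ) (f : ℂ → ℂ) (z : ℂ) : ℂ :=
  -(bdf z : ℂ) * Laplacian.laplacian f z + ((2 + 2 * γ : ℝ) : ℂ) * radial f z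
    - angular (angular f) z + (((γ + 1) ^ 2 : ℝ) : ℂ) * f z

section Calculus

variable {f g : ℂ → ℂ} {z : ℂ}

theorem angular_differentiableAt (hf : ContDiffAt ℝ ∞ f z) :
    DifferentiableAt ℝ (angular f) z := by
  have h1 : ContDiffAt ℝ 1 (fderiv ℝ f) z := hf.fderiv_right (by norm_cast)
  exact (h1.differentiableAt (by simp)).clm_apply (by fun_prop)

theorem eventually_contDiffAt (hf : ContDiffAt ℝ ∞ f z) :
    ∀ᶠ y in 𝓝 z, DifferentiableAt ℝ f y := by
  have h2 : ContDiffAt ℝ 1 f z := hf.of_le (by norm_cast)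
  filter_upwards [h2.eventually (by simp)] with y hy
  exact hy.differentiableAt (by simp)

theorem diskOp_add (γ : ℝ) (hf : ContDiffAt ℝ ∞ f z) (hg : ContDiffAt ℝ ∞ g z) :
    diskOp γ (f + g) z = diskOp γ f z + diskOp γ g z := by
  have hf2 : ContDiffAt ℝ 2 f z := hf.of_le (by norm_cast)
  have hg2 : ContDiffAt ℝ 2 g z := hg.of_le (by norm_cast)
  have hE : angular (f + g) =ᶠ[𝓝 z] angular f + angular g := by
    filter_upwards [eventually_contDiffAt hf, eventually_contDiffAt hg] with y h1 h2
    simp [angular, fderiv_add h1 h2]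
  have hA : angular (angular (f + g)) z = angular (angular f) z + angular (angular g) z := by
    rw [angular, hE.fderiv_eq, fderiv_add (angular_differentiableAt hf)
      (angular_differentiableAt hg)]
    rfl
  have hR : radial (f + g) z = radial f z + radial g z := by
    simp [radial, fderiv_add (hf2.differentiableAt (by simp)) (hg2.differentiableAt (by simp))]
  simp only [diskOp, hA, hR, hf2.laplacian_add hg2, Pi.add_apply]
  ring

theorem diskOp_smul (γ : ℝ) (c : ℂ) (hf : ContDiffAt ℝ ∞ f z) :
    diskOp γ (c • f) z = c * diskOp γ f z := by
  have hf2 : ContDiffAt ℝ 2 f z := hf.of_le (by norm_cast)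
  have hE : angular (c • f) =ᶠ[𝓝 z] c • angular f := by
    filter_upwards [eventually_contDiffAt hf] with y h1
    simp [angular, fderiv_const_smul h1]
  have hA : angular (angular (c • f)) z = c * angular (angular f) z := by
    rw [angular, hE.fderiv_eq, fderiv_const_smul (angular_differentiableAt hf)]
    rfl
  have hR : radial (c • f) z = c * radial f z := by
    simp [radial, fderiv_const_smul (hf2.differentiableAt (by simp))]
  simp only [diskOp, hA, hR, InnerProductSpace.laplacian_smul c hf2, Pi.smul_apply, smul_eq_mul]
  ring

theorem diskOp_eq_zero (γ : ℝ) (hf : f =ᶠ[𝓝 z] 0) : diskOp γ f z = 0 := by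
  have h0 : diskOp γ f z = diskOp γ 0 z := by
    have hE : angular f =ᶠ[𝓝 z] angular 0 := by
      filter_upwards [hf.eventuallyEq_nhds] with y hy
      simp [angular, hy.fderiv_eq]
    have hA : angular (angular f) z = angular (angular 0) z := by
      rw [angular, hE.fderiv_eq]; rfl
    have hR : radial f z = radial 0 z := by rw [radial, hf.fderiv_eq]; rfl
    simp only [diskOp, hA, hR, hf.eq_of_nhds,
      (InnerProductSpace.laplacian_congr_nhds hf).eq_of_nhds]
  rw [h0]
  have h1 := diskOp_smul (z := z) γ 0 (f := 0) contDiffAt_const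
  simpa using h1

/-- In polar coordinates `z = ρ e^{iω}` (with `ω = θ₀`), `0 < ρ < 1`, with `x = 1 - ρ²`, one has
`L_γ = -ρ⁻¹ x^{-γ} ∂_ρ (ρ x^{γ+1} ∂_ρ) - ρ⁻² ∂_ω² + (1 + γ)²`. -/
theorem diskOp_polar (γ : ℝ) (hf : ContDiffOn ℝ ∞ f (ball 0 1)) {ρ : ℝ} (h0 : 0 < ρ)
    (h1 : ρ < 1) (θ₀ : ℝ) :
    diskOp γ f (ρ * Complex.exp (θ₀ * Complex.I)) =
      -((ρ⁻¹ * (1 - ρ ^ 2) ^ (-γ) : ℝ) : ℂ) *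
          deriv (fun r : ℝ => ((r * (1 - r ^ 2) ^ (γ + 1) : ℝ) : ℂ) *
            deriv (fun s : ℝ => f (s * Complex.exp (θ₀ * Complex.I))) r) ρ
        - ((ρ ^ 2)⁻¹ : ℝ) * deriv (deriv fun θ : ℝ => f (ρ * Complex.exp (θ * Complex.I))) θ₀
        + (((1 + γ) ^ 2 : ℝ) : ℂ) * f (ρ * Complex.exp (θ₀ * Complex.I)) := by
  set e : ℂ := Complex.exp (θ₀ * Complex.I) with he
  have hen : ‖e‖ = 1 := Complex.norm_exp_ofReal_mul_I θ₀
  have hnorm : ∀ θ : ℝ, ‖(ρ : ℂ) * Complex.exp (θ * Complex.I)‖ = ρ := fun θ => by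
    rw [norm_mul, Complex.norm_exp_ofReal_mul_I, mul_one, Complex.norm_real, Real.norm_of_nonneg h0.le]
  have hcd : ∀ y ∈ ball (0 : ℂ) 1, ContDiffAt ℝ ∞ f y := fun y hy =>
    hf.contDiffAt (isOpen_ball.mem_nhds hy)
  have hmem : ∀ θ : ℝ, (ρ : ℂ) * Complex.exp (θ * Complex.I) ∈ ball (0 : ℂ) 1 := fun θ => by
    rw [mem_ball_zero_iff, hnorm θ]; exact h1
  have hz := hmem θ₀
  rw [← he] at hz
  have hx : 0 < 1 - ρ ^ 2 := by nlinarith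
  -- the angular part
  have hang : ∀ (g : ℂ → ℂ) (θ : ℝ),
      DifferentiableAt ℝ g (ρ * Complex.exp (θ * Complex.I)) →
      deriv (fun θ : ℝ => g (ρ * Complex.exp (θ * Complex.I))) θ =
        angular g (ρ * Complex.exp (θ * Complex.I)) := by
    intro g θ hg
    have hc : HasDerivAt (fun θ : ℝ => (ρ : ℂ) * Complex.exp (θ * Complex.I))
        (Complex.I * (ρ * Complex.exp (θ * Complex.I))) θ := by
      have := (((Complex.ofRealCLM.hasDerivAt (x := θ)).mul_const Complex.I).cexp).const_mul (ρ : ℂ)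
      refine this.congr_deriv ?_
      simp
      ring
    exact (hg.hasFDerivAt.comp_hasDerivAt θ hc).deriv
  have hang1 : (deriv fun θ : ℝ => f (ρ * Complex.exp (θ * Complex.I))) =
      fun θ : ℝ => angular f (ρ * Complex.exp (θ * Complex.I)) :=
    funext fun θ => hang f θ ((hcd _ (hmem θ)).differentiableAt (by simp))
  have hang2 := hang (angular f) θ₀ (angular_differentiableAt (hcd _ (hmem θ₀)))
  rw [hang1, hang2, ← he]
  set z : ℂ := ρ * e with hzdef
  have hD : DifferentiableAt ℝ (fderiv ℝ f) z := by
    have h1 : ContDiffAt ℝ 1 (fderiv ℝ f) z := (hcd z hz).fderiv_right (by norm_cast)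
    exact h1.differentiableAt (by simp)
  set B := fderiv ℝ (fderiv ℝ f) z with hB
  set D := fderiv ℝ f z with hDz
  have hAA : angular (angular f) z = B (Complex.I * z) (Complex.I * z) - D z := by
    have h2 : HasFDerivAt (fun y : ℂ => Complex.I * y)
        (ContinuousLinearMap.mul ℝ ℂ Complex.I) z :=
      (ContinuousLinearMap.mul ℝ ℂ Complex.I).hasFDerivAt
    have h3 := hD.hasFDerivAt.clm_apply h2
    have h4 : fderiv ℝ (angular f) z = _ := h3.fderiv
    rw [angular, h4]
    simp only [add_apply, ContinuousLinearMap.comp_apply,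
      ContinuousLinearMap.flip_apply, ContinuousLinearMap.mul_apply']
    rw [← mul_assoc, Complex.I_mul_I, neg_one_mul, map_neg]
    ring
  -- the radial part
  have hlin : ∀ r : ℝ, HasDerivAt (fun s : ℝ => (s : ℂ) * e) e r := fun r => by
    simpa using (Complex.ofRealCLM.hasDerivAt (x := r)).mul_const e
  have hrad : (fun r : ℝ => deriv (fun s : ℝ => f (s * e)) r) =ᶠ[𝓝 ρ]
      fun r : ℝ => fderiv ℝ f (r * e) e := by
    have hnear : ∀ᶠ r : ℝ in 𝓝 ρ, (r : ℂ) * e ∈ ball (0 : ℂ) 1 :=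
      (hlin ρ).continuousAt.eventually (isOpen_ball.mem_nhds hz)
    filter_upwards [hnear] with r hr
    exact (((hcd _ hr).differentiableAt (by simp)).hasFDerivAt.comp_hasDerivAt r (hlin r)).deriv
  have hrad2 : HasDerivAt (fun r : ℝ => deriv (fun s : ℝ => f (s * e)) r) (B e e) ρ := by
    have h5 : HasDerivAt (fun r : ℝ => fderiv ℝ f (r * e)) (B e) ρ :=
      hD.hasFDerivAt.comp_hasDerivAt ρ (hlin ρ)
    have h6 := h5.clm_apply (hasDerivAt_const ρ e)
    refine HasDerivAt.congr_of_eventuallyEq ?_ hrad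
    simpa using h6
  have hw : HasDerivAt (fun r : ℝ => r * (1 - r ^ 2) ^ (γ + 1))
      ((1 - ρ ^ 2) ^ (γ + 1) - 2 * ρ ^ 2 * (γ + 1) * (1 - ρ ^ 2) ^ γ) ρ := by
    have h7 : HasDerivAt (fun r : ℝ => 1 - r ^ 2) (-(2 * ρ)) ρ := by
      simpa using (hasDerivAt_pow 2 ρ).const_sub 1
    have h8 := (hasDerivAt_id ρ).mul (h7.rpow_const (p := γ + 1) (Or.inl hx.ne'))
    refine h8.congr_deriv ?_
    simp
    ring
  have hprod := (hw.ofReal_comp.mul hrad2).deriv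
  have hval : deriv (fun s : ℝ => f (s * e)) ρ = D e := hrad.eq_of_nhds
  have hprod' : deriv (fun r : ℝ => ((r * (1 - r ^ 2) ^ (γ + 1) : ℝ) : ℂ) *
      deriv (fun s : ℝ => f (s * e)) r) ρ =
      (((1 - ρ ^ 2) ^ (γ + 1) - 2 * ρ ^ 2 * (γ + 1) * (1 - ρ ^ 2) ^ γ : ℝ) : ℂ) * D e +
        ((ρ * (1 - ρ ^ 2) ^ (γ + 1) : ℝ) : ℂ) * B e e := by
    rw [← hval]; exact hprod
  rw [hprod']
  -- the Laplacian
  have hsc : ∀ (a : ℝ) (y : ℂ), (a : ℂ) * y = a • y := fun a y => by simp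
  have hLap : Laplacian.laplacian f z = B e e + B (Complex.I * e) (Complex.I * e) := by
    rw [InnerProductSpace.laplacian_eq_iteratedFDeriv_complexPlane]
    simp only [iteratedFDeriv_two_apply, Matrix.cons_val_zero, Matrix.cons_val_one, ← hB]
    have hab : e.re ^ 2 + e.im ^ 2 = 1 := by
      have := Complex.sq_norm e
      rw [hen, Complex.normSq_apply] at this
      nlinarith
    have e1 : e = e.re • (1 : ℂ) + e.im • Complex.I := by
      simp [Complex.re_add_im]
    have e2 : Complex.I * e = (-e.im) • (1 : ℂ) + e.re • Complex.I := by
      apply Complex.ext <;> simp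
    have e3 : B e e = B (e.re • (1 : ℂ) + e.im • Complex.I)
        (e.re • (1 : ℂ) + e.im • Complex.I) := by rw [← e1]
    rw [e2, e3]
    simp only [map_add, map_smul, add_apply, smul_apply]
    simp only [Complex.real_smul]
    have hab' : (e.re : ℂ) ^ 2 + (e.im : ℂ) ^ 2 = 1 := by exact_mod_cast hab
    push_cast
    linear_combination (-(B 1 1 + B Complex.I Complex.I)) * hab'
  have hIz : B (Complex.I * z) (Complex.I * z) = (ρ : ℂ) ^ 2 * B (Complex.I * e) (Complex.I * e) := by
    have : Complex.I * z = ρ • (Complex.I * e) := by rw [hzdef, ← hsc]; ring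
    rw [this, map_smul, map_smul, smul_apply, ← hsc, ← hsc]
    ring
  have hDe : D z = (ρ : ℂ) * D e := by rw [hzdef, hsc, map_smul, hsc]
  have hbdf : bdf z = 1 - ρ ^ 2 := by rw [bdf, hzdef, he, hnorm]
  have hpow : (1 - ρ ^ 2) ^ (γ + 1) = (1 - ρ ^ 2) ^ γ * (1 - ρ ^ 2) := Real.rpow_add_one hx.ne' γ
  have hneg : (1 - ρ ^ 2) ^ (-γ) = ((1 - ρ ^ 2) ^ γ)⁻¹ := Real.rpow_neg hx.le γ
  have hX : (((1 - ρ ^ 2) ^ γ : ℝ) : ℂ) ≠ 0 := by exact_mod_cast (Real.rpow_pos_of_pos hx γ).ne'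
  have hρ : (ρ : ℂ) ≠ 0 := by exact_mod_cast h0.ne'
  rw [diskOp, radial, hAA, hIz, ← hDz, hDe, hLap, hbdf, hpow, hneg]
  generalize (1 - ρ ^ 2) ^ γ = X at hX ⊢
  push_cast
  field_simp
  ring

end Calculus

/-! ### The Hilbert space `L²(𝔻, x^γ dV)` -/

/-- The measure `x^γ dV` on the unit disk. The unit circle is a null set for the Lebesgue measure,
so that the open disk carries the whole measure. -/
def diskMeasure (γ : ℝ) : Measure ℂ :=
  (volume.restrict (ball (0 : ℂ) 1)).withDensity fun z => ENNReal.ofReal (bdf z ^ γ)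

/-- The Hilbert space `L²_γ = L²(𝔻, x^γ dV)` of complex-valued functions. -/
abbrev DiskL2 (γ : ℝ) : Type := Lp ℂ 2 (diskMeasure γ)

theorem ae_diskMeasure_iff (γ : ℝ) (p : ℂ → Prop) :
    (∀ᵐ z ∂diskMeasure γ, p z) ↔ ∀ᵐ z ∂volume.restrict (ball (0 : ℂ) 1), p z := by
  have hm : Measurable fun z : ℂ => ENNReal.ofReal (bdf z ^ γ) := by
    unfold bdf; fun_prop
  rw [diskMeasure, ae_withDensity_iff hm]
  refine eventually_congr ?_
  filter_upwards [ae_restrict_mem measurableSet_ball] with z hz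
  have hz1 : ‖z‖ < 1 := by simpa using hz
  have hx : 0 < bdf z := by
    unfold bdf; nlinarith [norm_nonneg z]
  simp [Real.rpow_pos_of_pos hx γ]

/-! ### Spaces of smooth functions on the disk -/

/-- `C^∞(𝔻^{int})`: functions that are smooth in the open unit disk. The values of the function
outside the open disk are irrelevant. -/
def smoothInterior : Submodule ℂ (ℂ → ℂ) where
  carrier := {f | ContDiffOn ℝ ∞ f (ball 0 1)}
  zero_mem' := contDiffOn_const
  add_mem' hf hg := ContDiffOn.add hf hg
  smul_mem' c _ hf := ContDiffOn.const_smul c hf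

/-- `Ċ^∞(𝔻)`: functions that are smooth on the closed unit disk (up to and including the boundary)
and all of whose derivatives, of every order `n ≥ 0`, vanish on the unit circle. -/
def smoothFlat : Submodule ℂ (ℂ → ℂ) where
  carrier := {f | ContDiffOn ℝ ∞ f (closedBall 0 1) ∧
    ∀ (n : ℕ) (z : ℂ), ‖z‖ = 1 → iteratedFDerivWithin ℝ n f (closedBall 0 1) z = 0}
  zero_mem' := by
    refine ⟨contDiffOn_const, fun n z _ => ?_⟩
    have h : iteratedFDerivWithin ℝ n (0 : ℂ → ℂ) (closedBall 0 1) = 0 :=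
      iteratedFDerivWithin_fun_zero
    rw [h, Pi.zero_apply]
  add_mem' := by
    rintro f g ⟨hf, hf'⟩ ⟨hg, hg'⟩
    refine ⟨hf.add hg, fun n z hz => ?_⟩
    have hzm : z ∈ closedBall (0 : ℂ) 1 := by simp [hz]
    have hU : UniqueDiffOn ℝ (closedBall (0 : ℂ) 1) :=
      uniqueDiffOn_convex (convex_closedBall _ _) ⟨0, by simp [interior_closedBall]⟩
    have hn : ((n : ℕ∞) : WithTop ℕ∞) ≤ ∞ := by exact_mod_cast le_top
    rw [iteratedFDerivWithin_add_apply ((hf z hzm).of_le hn) ((hg z hzm).of_le hn) hU hzm,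
      hf' n z hz, hg' n z hz, add_zero]
  smul_mem' := by
    rintro c f ⟨hf, hf'⟩
    refine ⟨hf.const_smul c, fun n z hz => ?_⟩
    have hzm : z ∈ closedBall (0 : ℂ) 1 := by simp [hz]
    have hU : UniqueDiffOn ℝ (closedBall (0 : ℂ) 1) :=
      uniqueDiffOn_convex (convex_closedBall _ _) ⟨0, by simp [interior_closedBall]⟩
    have hn : ((n : ℕ∞) : WithTop ℕ∞) ≤ ∞ := by exact_mod_cast le_top
    rw [iteratedFDerivWithin_const_smul_apply ((hf z hzm).of_le hn) hU hzm, hf' n z hz, smul_zero]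

/-- `C_c^∞(𝔻^{int})`: smooth functions with compact support in the open unit disk. -/
def smoothCompact : Submodule ℂ (ℂ → ℂ) where
  carrier := {f | ContDiff ℝ ∞ f ∧ HasCompactSupport f ∧ tsupport f ⊆ ball 0 1}
  zero_mem' := ⟨contDiff_const, HasCompactSupport.zero, by simp [tsupport]⟩
  add_mem' := by
    rintro f g ⟨hf, hf', hf''⟩ ⟨hg, hg', hg''⟩
    exact ⟨hf.add hg, hf'.add hg', (tsupport_add f g).trans (Set.union_subset hf'' hg'')⟩
  smul_mem' := by
    rintro c f ⟨hf, hf', hf''⟩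
    exact ⟨hf.const_smul c, hf'.smul_left (f := fun _ => c),
      (closure_mono (Function.support_const_smul_subset c f)).trans hf''⟩

theorem smoothFlat_le : smoothFlat ≤ smoothInterior :=
  fun _ hf => hf.1.mono ball_subset_closedBall

theorem smoothCompact_le : smoothCompact ≤ smoothInterior :=
  fun _ hf => hf.1.contDiffOn

/-! ### Realizations of `L_γ` in `L²_γ` -/

theorem contDiffAt_of_mem {f : ℂ → ℂ} (hf : f ∈ smoothInterior) {z : ℂ} (hz : z ∈ ball (0 : ℂ) 1) :
    ContDiffAt ℝ ∞ f z :=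
  ContDiffOn.contDiffAt hf (isOpen_ball.mem_nhds hz)

/-- The graph, in `L²_γ × L²_γ`, of `L_γ` with domain a given space `P` of smooth functions: all
pairs of classes `([f], [L_γ f])` with `f ∈ P`. -/
def opGraph (γ : ℝ) (P : Submodule ℂ (ℂ → ℂ)) (hP : P ≤ smoothInterior) :
    Submodule ℂ (DiskL2 γ × DiskL2 γ) where
  carrier := {p | ∃ f ∈ P, p.1 =ᵐ[diskMeasure γ] f ∧ p.2 =ᵐ[diskMeasure γ] diskOp γ f}
  zero_mem' := by
    refine ⟨0, P.zero_mem, Lp.coeFn_zero _ _ _, ?_⟩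
    have h : diskOp γ 0 = 0 := funext fun z => diskOp_eq_zero γ EventuallyEq.rfl
    rw [h]
    exact Lp.coeFn_zero _ _ _
  add_mem' := by
    rintro p q ⟨f, hf, hf1, hf2⟩ ⟨g, hg, hg1, hg2⟩
    refine ⟨f + g, P.add_mem hf hg, (Lp.coeFn_add _ _).trans (hf1.add hg1), ?_⟩
    refine (Lp.coeFn_add _ _).trans ((hf2.add hg2).trans ?_)
    refine (ae_diskMeasure_iff γ _).2 ?_
    filter_upwards [ae_restrict_mem measurableSet_ball] with z hz
    exact (diskOp_add γ (contDiffAt_of_mem (hP hf) hz) (contDiffAt_of_mem (hP hg) hz)).symm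
  smul_mem' := by
    rintro c p ⟨f, hf, hf1, hf2⟩
    refine ⟨c • f, P.smul_mem c hf, (Lp.coeFn_smul _ _).trans (hf1.const_smul c), ?_⟩
    refine (Lp.coeFn_smul _ _).trans ((hf2.const_smul c).trans ?_)
    refine (ae_diskMeasure_iff γ _).2 ?_
    filter_upwards [ae_restrict_mem measurableSet_ball] with z hz
    exact (diskOp_smul γ c (contDiffAt_of_mem (hP hf) hz)).symm

/-- `opGraph` is the graph of a (single-valued) operator: a smooth function that vanishes almost
everywhere in the disk is annihilated by `L_γ`. -/
theorem opGraph_singleValued (γ : ℝ) (P : Submodule ℂ (ℂ → ℂ)) (hP : P ≤ smoothInterior) :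
    ∀ p ∈ opGraph γ P hP, p.1 = 0 → p.2 = 0 := by
  rintro ⟨u, v⟩ ⟨f, hf, hf1, hf2⟩ hu
  dsimp only at hf1 hf2 hu ⊢
  subst hu
  have h0 : f =ᵐ[diskMeasure γ] 0 := hf1.symm.trans (Lp.coeFn_zero _ _ _)
  have h1 : f =ᵐ[volume.restrict (ball (0 : ℂ) 1)] 0 := (ae_diskMeasure_iff γ _).1 h0
  have h2 : Set.EqOn f 0 (ball 0 1) :=
    Measure.eqOn_open_of_ae_eq h1 isOpen_ball (ContDiffOn.continuousOn (hP hf)) continuousOn_const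
  refine Lp.ext (hf2.trans (EventuallyEq.trans ?_ (Lp.coeFn_zero _ _ _).symm))
  refine (ae_diskMeasure_iff γ _).2 ?_
  filter_upwards [ae_restrict_mem measurableSet_ball] with z hz
  exact diskOp_eq_zero γ (h2.eventuallyEq_of_mem (isOpen_ball.mem_nhds hz))

/-- The unbounded operator `(L_γ, P)` in `L²_γ`: it sends the class of `f ∈ P` to the class
of `L_γ f`. -/
def opOn (γ : ℝ) (P : Submodule ℂ (ℂ → ℂ)) (hP : P ≤ smoothInterior) :
    DiskL2 γ →ₗ.[ℂ] DiskL2 γ :=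
  (opGraph γ P hP).toLinearPMap

theorem opOn_graph (γ : ℝ) (P : Submodule ℂ (ℂ → ℂ)) (hP : P ≤ smoothInterior) :
    (opOn γ P hP).graph = opGraph γ P hP :=
  Submodule.toLinearPMap_graph_eq _ (opGraph_singleValued γ P hP)

/-- The preminimal operator `(L_γ, Ċ^∞(𝔻))`. -/
def preminimal (γ : ℝ) : DiskL2 γ →ₗ.[ℂ] DiskL2 γ := opOn γ smoothFlat smoothFlat_le

/-- The minimal operator `L_{γ,min}`: the closure of the preminimal operator. -/
def minimal (γ : ℝ) : DiskL2 γ →ₗ.[ℂ] DiskL2 γ := (preminimal γ).closure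

/-- The operator `(L_γ, C_c^∞(𝔻^{int}))`. -/
def compactOp (γ : ℝ) : DiskL2 γ →ₗ.[ℂ] DiskL2 γ := opOn γ smoothCompact smoothCompact_le

/-! ### The Friedrichs extension -/

section Friedrichs

variable {H : Type*} [NormedAddCommGroup H] [InnerProductSpace ℂ H]

/-- The sesquilinear form `α(u, v) = (T u, v)` of an operator `T`, linear in `u`
(Mathlib's inner product is linear in its second argument). -/
def form (T : H →ₗ.[ℂ] H) (u v : T.domain) : ℂ := inner ℂ (v : H) (T u)

/-- The sequence `u n` in the domain of `T` `α`-converges to `x`: it converges to `x` in the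
Hilbert space and `α(u n - u m, u n - u m) → 0` as `m, n → ∞`. -/
def FormTendsto (T : H →ₗ.[ℂ] H) (u : ℕ → T.domain) (x : H) : Prop :=
  Tendsto (fun n => (u n : H)) atTop (𝓝 x) ∧
    Tendsto (fun p : ℕ × ℕ => form T (u p.1 - u p.2) (u p.1 - u p.2)) atTop (𝓝 0)

/-- The form domain `V`: the `α`-closure of the domain of `T`. -/
def formDomain (T : H →ₗ.[ℂ] H) : Set H := {x | ∃ u, FormTendsto T u x}

/-- `α̃(x, y) = c` for the extension by continuity `α̃` of the form `α` to the form domain. -/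
def HasFormValue (T : H →ₗ.[ℂ] H) (x y : H) (c : ℂ) : Prop :=
  x ∈ formDomain T ∧ y ∈ formDomain T ∧
    ∀ u v : ℕ → T.domain, FormTendsto T u x → FormTendsto T v y →
      Tendsto (fun n => form T (u n) (v n)) atTop (𝓝 c)

/-- `S` is the Friedrichs extension of the densely defined, symmetric, nonnegative operator `T`:
`x ∈ dom S` and `S x = w` hold exactly when `x` lies in the form domain `V` and
`α̃(x, y) = (w, y)` for all `y ∈ V`. -/
structure IsFriedrichsExtension (T S : H →ₗ.[ℂ] H) : Prop where
  dense : Dense (T.domain : Set H)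
  symmetric : T.IsFormalAdjoint T
  nonneg : ∀ u : T.domain, 0 ≤ (form T u u).re
  mem_graph_iff : ∀ x w : H, (x, w) ∈ S.graph ↔
    x ∈ formDomain T ∧ ∀ y ∈ formDomain T, HasFormValue T x y (inner ℂ y w)

end Friedrichs

end DiskOperator

end

/-! Write T for `compactOp γ`. The point is that T is already essentially self-adjoint; the other
operator-theoretic claims then follow formally. Green's formula (`integral_diskOp_mul_conj`) makes T
symmetric and nonnegative and, after a cutoff, places the preminimal operator inside the adjoint T†.
Once T† is the closure of T, the minimal operator is squeezed between the two. A closure that equals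
the adjoint is self-adjoint, is the Friedrichs extension (`isFriedrichsExtension_of_graph_adjoint`),
and leaves no room for a second self-adjoint extension.

For symmetric nonnegative T it suffices that 1 + T has dense range
(`LinearPMap.graph_adjoint_eq_topologicalClosure`): a v in L²_γ orthogonal to (1 + L_γ) C_c^∞ must
vanish. Let γ ≥ 1 and let g be smooth up to the boundary. Cutting g off at x ~ 1/n commutes with L_γ
up to an error of size O(n) supported in the collar x ≤ 2/n: when two derivatives fall on the
cutoff, a factor x absorbs one power of n. Since x^γ ≤ x, the collar has measure O(n⁻²), so the
errors are bounded in L²_γ and tend weakly to zero. Hence v is orthogonal to (1 + L_γ) g too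
(`integral_one_add_diskOp_eq_zero`). On the monomials z^a z̄^b the operator is triangular with
diagonal entries (a + b + γ + 1)² ≥ 0, so v is orthogonal to every monomial
(`integral_monomial_eq_zero`), and Stone–Weierstrass gives v = 0.

For γ ≤ -1, multiplication by x^{-γ} carries L_{-γ} to L_γ, preserves C_c^∞ and maps L²_{-γ}
isometrically to L²_γ (`diskOp_rpow_mul`, `memLp_rpow_mul`), which reduces to the first case. -/

open scoped ComplexConjugate

/-! ### Essential self-adjointness of nonnegative symmetric operators -/

namespace LinearPMap

variable {H : Type*} [NormedAddCommGroup H] [InnerProductSpace ℂ H]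

/-- A dense-range criterion for essential self-adjointness: if `T` is symmetric and nonnegative and
`1 + T` has dense range, the adjoint of `T` is the closure of `T`. -/
theorem graph_adjoint_eq_topologicalClosure [CompleteSpace H] {T : H →ₗ.[ℂ] H}
    (hd : Dense (T.domain : Set H)) (hs : T.IsFormalAdjoint T)
    (hn : ∀ u : T.domain, 0 ≤ (inner ℂ (u : H) (T u)).re)
    (hr : ∀ v : H, (∀ u : T.domain, inner ℂ ((u : H) + T u) v = 0) → v = 0) :
    T†.graph = T.graph.topologicalClosure := by
  have hle : T.graph.topologicalClosure ≤ T†.graph := by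
    refine Submodule.topologicalClosure_minimal _ (le_graph_of_le (hs.le_adjoint hd)) ?_
    exact adjoint_isClosed hd
  refine le_antisymm ?_ hle
  rintro ⟨v, w⟩ hvw
  set R : T.domain →ₗ[ℂ] H := T.domain.subtype + T.toFun with hR
  have hRa : ∀ u : T.domain, R u = (u : H) + T u := fun u => rfl
  have hdr : (LinearMap.range R).topologicalClosure = ⊤ := by
    rw [Submodule.topologicalClosure_eq_top_iff, Submodule.eq_bot_iff]
    intro x hx
    refine hr x fun u => ?_
    exact (Submodule.mem_orthogonal _ _).1 hx _ ⟨u, rfl⟩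
  have hmem : v + w ∈ _root_.closure (LinearMap.range R : Set H) := by
    rw [← Submodule.topologicalClosure_coe, hdr]; trivial
  obtain ⟨y, hy, hlim⟩ := mem_closure_iff_seq_limit.1 hmem
  choose u hu using hy
  -- Nonnegativity makes 1 + T bounded below by 1, so convergence of (1 + T) u_n forces convergence
  -- of u_n and of T u_n.
  have hbound : ∀ a : T.domain, ‖(a : H)‖ ≤ ‖R a‖ := by
    intro a
    have h1 : ‖(a : H)‖ ^ 2 ≤ ‖(a : H)‖ * ‖R a‖ := by
      have h2 : (inner ℂ (a : H) (R a)).re ≤ ‖(a : H)‖ * ‖R a‖ :=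
        (Complex.re_le_norm _).trans (norm_inner_le_norm _ _)
      have h3 : (inner ℂ (a : H) (a : H)).re = ‖(a : H)‖ ^ 2 := by
        simpa using (norm_sq_eq_re_inner (𝕜 := ℂ) (a : H)).symm
      rw [hRa, inner_add_right, Complex.add_re, h3] at h2
      have := hn a
      rw [hRa]
      linarith
    rcases (norm_nonneg (a : H)).eq_or_lt with h0 | h0
    · rw [← h0]; exact norm_nonneg _
    · nlinarith
  have hcau : CauchySeq fun n => (u n : H) := by
    have hc := hlim.cauchySeq
    rw [Metric.cauchySeq_iff'] at hc ⊢
    intro ε hε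
    obtain ⟨N, hN⟩ := hc ε hε
    refine ⟨N, fun n hn' => lt_of_le_of_lt ?_ (hN n hn')⟩
    rw [dist_eq_norm, dist_eq_norm, ← hu n, ← hu N, ← R.map_sub]
    exact hbound (u n - u N)
  obtain ⟨x, hx⟩ := cauchySeq_tendsto_of_complete hcau
  have hTx : Tendsto (fun n => T (u n)) atTop (𝓝 (v + w - x)) := by
    refine (hlim.sub hx).congr fun n => ?_
    rw [← hu n, hRa]; abel
  have hxg : (x, v + w - x) ∈ T.graph.topologicalClosure :=
    mem_closure_of_tendsto (hx.prodMk_nhds hTx) (Eventually.of_forall fun n => T.mem_graph (u n))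
  -- The difference is (v - x, -(v - x)). An eigenvector of T† for the eigenvalue -1 is orthogonal
  -- to the range of 1 + T, hence zero.
  have hdiff := T†.graph.sub_mem hvw (hle hxg)
  rw [adjoint_graph_eq_graph_adjoint hd, Submodule.mem_adjoint_iff] at hdiff
  have hz : v - x = 0 := by
    refine hr _ fun a => ?_
    have h4 := hdiff _ _ (T.mem_graph a)
    have h5 : ((v, w) - (x, v + w - x) : H × H).2 = -(v - x) := by
      simp only [Prod.snd_sub]; abel
    rw [h5, inner_neg_right] at h4
    rw [inner_add_left]
    simpa [add_comm] using h4
  have hvx : v = x := sub_eq_zero.1 hz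
  have : v + w - x = w := by rw [hvx]; abel
  rwa [this, ← hvx] at hxg

/-- A symmetric operator whose adjoint is its closure has a self-adjoint closure. -/
theorem adjoint_adjoint_eq_of_graph_adjoint [CompleteSpace H] {T : H →ₗ.[ℂ] H}
    (hd : Dense (T.domain : Set H)) (hs : T.IsFormalAdjoint T)
    (h : T†.graph = T.graph.topologicalClosure) : T†† = T† := by
  have hle : T ≤ T† := hs.le_adjoint hd
  have hd' : Dense (T†.domain : Set H) := hd.mono hle.1
  refine eq_of_eq_graph ?_
  ext ⟨c, d⟩
  rw [adjoint_graph_eq_graph_adjoint hd', Submodule.mem_adjoint_iff]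
  constructor
  · intro hcd
    rw [adjoint_graph_eq_graph_adjoint hd, Submodule.mem_adjoint_iff]
    exact fun a b hab => hcd a b (le_graph_of_le hle hab)
  · intro hcd a b hab
    rw [adjoint_graph_eq_graph_adjoint hd, Submodule.mem_adjoint_iff] at hcd
    -- A pair in the graph of T† is a limit of pairs in the graph of T, and the pairing identity is
    -- a closed condition.
    rw [h] at hab
    have hcl : _root_.IsClosed {p : H × H | inner ℂ p.2 c - inner ℂ p.1 d = 0} :=
      isClosed_eq (by fun_prop) continuous_const
    exact closure_minimal (fun p hp => hcd p.1 p.2 hp) hcl hab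

/-- The adjoint reverses inclusions. -/
theorem adjoint_le_adjoint [CompleteSpace H] {T S : H →ₗ.[ℂ] H}
    (hd : Dense (T.domain : Set H)) (h : T ≤ S) : S† ≤ T† := by
  have hd' : Dense (S.domain : Set H) := hd.mono h.1
  refine le_of_le_graph ?_
  rw [adjoint_graph_eq_graph_adjoint hd, adjoint_graph_eq_graph_adjoint hd']
  intro p hp
  rw [Submodule.mem_adjoint_iff] at hp ⊢
  exact fun a b hab => hp a b (le_graph_of_le h hab)

end LinearPMap

namespace DiskOperator

/-! ### Form convergence and the Friedrichs extension -/

section FormConvergence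

variable {H : Type*} [NormedAddCommGroup H] [InnerProductSpace ℂ H] {T : H →ₗ.[ℂ] H}

theorem form_add_left (u v w : T.domain) : form T (u + v) w = form T u w + form T v w := by
  simp [form, LinearPMap.map_add]

theorem form_sub_left (u v w : T.domain) : form T (u - v) w = form T u w - form T v w := by
  simp [form, LinearPMap.map_sub]

theorem form_sub_right (u v w : T.domain) : form T u (v - w) = form T u v - form T u w := by
  simp [form]

theorem form_add_right (u v w : T.domain) : form T u (v + w) = form T u v + form T u w := by
  simp [form]

theorem form_conj (hs : T.IsFormalAdjoint T) (u v : T.domain) :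
    starRingEnd ℂ (form T u v) = form T v u := by
  rw [form, form, inner_conj_symm]
  exact hs u v

/-- The Cauchy–Schwarz inequality for a nonnegative form. -/
theorem norm_form_sq_le (hs : T.IsFormalAdjoint T) (hn : ∀ u : T.domain, 0 ≤ (form T u u).re)
    (u v : T.domain) : ‖form T u v‖ ^ 2 ≤ (form T u u).re * (form T v v).re := by
  -- The arguments are swapped because `form` is linear in its first slot. The form may be
  -- degenerate, which a pre-inner product allows.
  let c : PreInnerProductSpace.Core ℂ T.domain :=
    { inner := fun u v => form T v u
      conj_inner_symm := fun u v => form_conj hs u v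
      re_inner_nonneg := fun u => hn u
      add_left := fun u v w => form_add_right _ _ _
      smul_left := fun u v r => by simp [form, mul_comm] }
  have h := @InnerProductSpace.Core.inner_mul_inner_self_le ℂ T.domain _ _ _ c v u
  change ‖form T u v‖ * ‖form T v u‖ ≤ (form T v v).re * (form T u u).re at h
  rw [← form_conj hs u v, RCLike.norm_conj] at h
  nlinarith

/-- Parallelogram law with the nonnegative term α(u - v, u - v) dropped. -/
theorem re_form_add_le (hn : ∀ u : T.domain, 0 ≤ (form T u u).re) (u v : T.domain) :
    (form T (u + v) (u + v)).re ≤ 2 * (form T u u).re + 2 * (form T v v).re := by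
  have h := hn (u - v)
  simp only [form_sub_left, form_sub_right, form_add_left, form_add_right, Complex.add_re,
    Complex.sub_re] at h ⊢
  linarith

theorem re_form_sub_le (hn : ∀ u : T.domain, 0 ≤ (form T u u).re) (u v : T.domain) :
    (form T (u - v) (u - v)).re ≤ 2 * (form T u u).re + 2 * (form T v v).re := by
  have h := hn (u + v)
  simp only [form_sub_left, form_sub_right, form_add_left, form_add_right, Complex.add_re,
    Complex.sub_re] at h ⊢
  linarith

theorem formTendsto_const (u : T.domain) : FormTendsto T (fun _ => u) (u : H) :=
  ⟨tendsto_const_nhds, by simp [form]⟩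

theorem mem_formDomain (u : T.domain) : (u : H) ∈ formDomain T := ⟨_, formTendsto_const u⟩

theorem FormTendsto.re_tendsto {u : ℕ → T.domain} {x : H} (hu : FormTendsto T u x) :
    Tendsto (fun p : ℕ × ℕ => (form T (u p.1 - u p.2) (u p.1 - u p.2)).re) atTop (𝓝 0) := by
  have h := (Complex.continuous_re.tendsto 0).comp hu.2
  rwa [Complex.zero_re] at h

theorem FormTendsto.exists_bound (hn : ∀ u : T.domain, 0 ≤ (form T u u).re)
    {u : ℕ → T.domain} {x : H} (hu : FormTendsto T u x) :
    ∃ C, ∀ᶠ n in atTop, (form T (u n) (u n)).re ≤ C := by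
  have h1 := hu.re_tendsto.eventually (gt_mem_nhds one_pos)
  rw [eventually_atTop_prod_self] at h1
  obtain ⟨N, hN⟩ := h1
  refine ⟨2 * 1 + 2 * (form T (u N) (u N)).re, eventually_atTop.2 ⟨N, fun n hnN => ?_⟩⟩
  have h2 := re_form_add_le hn (u n - u N) (u N)
  have h3 := hN n N hnN le_rfl
  rw [sub_add_cancel] at h2
  dsimp only at h3
  linarith

/-- The form of a symmetric nonnegative operator is closable. -/
theorem FormTendsto.re_form_sub_tendsto (hs : T.IsFormalAdjoint T)
    (hn : ∀ u : T.domain, 0 ≤ (form T u u).re) {u v : ℕ → T.domain} {x : H}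
    (hu : FormTendsto T u x) (hv : FormTendsto T v x) :
    Tendsto (fun n => (form T (u n - v n) (u n - v n)).re) atTop (𝓝 0) := by
  set a : ℕ → T.domain := fun n => u n - v n with ha
  have ha0 : Tendsto (fun n => (a n : H)) atTop (𝓝 0) := by
    simpa [ha] using hu.1.sub hv.1
  have hcau : ∀ ε > 0, ∃ N, ∀ n m, N ≤ n → N ≤ m → (form T (a n - a m) (a n - a m)).re < ε := by
    intro ε hε
    have h1 := (hu.re_tendsto.eventually (gt_mem_nhds (show (0 : ℝ) < ε / 4 by positivity))).and
      (hv.re_tendsto.eventually (gt_mem_nhds (show (0 : ℝ) < ε / 4 by positivity)))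
    rw [eventually_atTop_prod_self] at h1
    obtain ⟨N, hN⟩ := h1
    refine ⟨N, fun n m h2 h3 => ?_⟩
    have h4 := re_form_sub_le hn (u n - u m) (v n - v m)
    have h5 : u n - u m - (v n - v m) = a n - a m := by simp only [ha]; abel
    obtain ⟨h6, h7⟩ := hN n m h2 h3
    rw [h5] at h4
    linarith
  rw [Metric.tendsto_atTop]
  intro ε hε
  obtain ⟨N, hN⟩ := hcau (ε / 2) (by positivity)
  refine ⟨N, fun n hnN => ?_⟩
  -- With n fixed, α(a n, a m) = (T (a n), a m) tends to 0 because a m → 0 in H. Expanding α(a n - a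
  -- m, a n - a m) < ε/2 then leaves α(a n, a n) < ε/2 + 2 · ε/4.
  have hlim : Tendsto (fun m => (form T (a n) (a m)).re) atTop (𝓝 0) := by
    have h1 : Tendsto (fun m => inner ℂ (a m : H) (T (a n))) atTop (𝓝 (inner ℂ (0 : H) (T (a n)))) :=
      ha0.inner tendsto_const_nhds
    rw [inner_zero_left] at h1
    have h2 := (Complex.continuous_re.tendsto 0).comp h1
    rwa [Complex.zero_re] at h2
  obtain ⟨m, hm, hmN⟩ := ((hlim.eventually (gt_mem_nhds (show (0 : ℝ) < ε / 4 by positivity))).and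
    (eventually_ge_atTop N)).exists
  have h2 := hN n m hnN hmN
  have h3 : (form T (a m) (a n)).re = (form T (a n) (a m)).re := by
    rw [← form_conj hs (a n) (a m), Complex.conj_re]
  have h4 := hn (a m)
  simp only [form_sub_left, form_sub_right, Complex.sub_re] at h2
  rw [Real.dist_eq, sub_zero, abs_of_nonneg (hn (a n))]
  linarith

theorem formTendsto_of_graph_tendsto {u : ℕ → T.domain} {x w : H}
    (hu : Tendsto (fun n => (u n : H)) atTop (𝓝 x))
    (hw : Tendsto (fun n => T (u n)) atTop (𝓝 w)) : FormTendsto T u x := by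
  refine ⟨hu, ?_⟩
  have h1 : Tendsto (fun p : ℕ × ℕ => ((u p.1 : H) - u p.2)) atTop (𝓝 (x - x)) := by
    rw [← prod_atTop_atTop_eq]
    exact (hu.comp tendsto_fst).sub (hu.comp tendsto_snd)
  have h2 : Tendsto (fun p : ℕ × ℕ => (T (u p.1) - T (u p.2))) atTop (𝓝 (w - w)) := by
    rw [← prod_atTop_atTop_eq]
    exact (hw.comp tendsto_fst).sub (hw.comp tendsto_snd)
  have h3 : Tendsto (fun p : ℕ × ℕ => inner ℂ ((u p.1 : H) - u p.2) (T (u p.1) - T (u p.2))) atTop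
      (𝓝 (inner ℂ (x - x) (w - w))) := h1.inner h2
  simpa [form, LinearPMap.map_sub] using h3

/-- Along the graph-convergent sequence u₀ the limit is that of (T u₀, v), which is evident.
Replacing u₀ by u costs α(u - u₀, v), which Cauchy–Schwarz controls: α(u - u₀, u - u₀) → 0 by
closability, and α(v, v) stays bounded. -/
theorem tendsto_form_of_graph_tendsto (hs : T.IsFormalAdjoint T)
    (hn : ∀ u : T.domain, 0 ≤ (form T u u).re) {u₀ u v : ℕ → T.domain} {x y w : H}
    (hu₀ : Tendsto (fun n => (u₀ n : H)) atTop (𝓝 x))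
    (hw : Tendsto (fun n => T (u₀ n)) atTop (𝓝 w))
    (hu : FormTendsto T u x) (hv : FormTendsto T v y) :
    Tendsto (fun n => form T (u n) (v n)) atTop (𝓝 (inner ℂ y w)) := by
  have h1 : Tendsto (fun n => form T (u₀ n) (v n)) atTop (𝓝 (inner ℂ y w)) := hv.1.inner hw
  have h2 := hu.re_form_sub_tendsto hs hn (formTendsto_of_graph_tendsto hu₀ hw)
  obtain ⟨C, hC⟩ := hv.exists_bound hn
  have h3 : Tendsto (fun n => form T (u n - u₀ n) (v n)) atTop (𝓝 0) := by
    have h4 : Tendsto (fun n => √((form T (u n - u₀ n) (u n - u₀ n)).re * C)) atTop (𝓝 0) := by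
      have := (h2.mul_const C).sqrt
      simpa using this
    refine squeeze_zero_norm' ?_ h4
    filter_upwards [hC] with n hCn
    refine Real.le_sqrt_of_sq_le ((norm_form_sq_le hs hn _ _).trans ?_)
    exact mul_le_mul_of_nonneg_left hCn (hn _)
  refine (h3.add h1).congr' ?_ |>.trans (by rw [zero_add])
  filter_upwards with n
  rw [form_sub_left, sub_add_cancel]

/-- If the adjoint of a symmetric nonnegative operator is its closure, then the closure is the
Friedrichs extension. -/
theorem isFriedrichsExtension_of_graph_adjoint [CompleteSpace H]
    (hd : Dense (T.domain : Set H)) (hs : T.IsFormalAdjoint T)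
    (hn : ∀ u : T.domain, 0 ≤ (form T u u).re) {S : H →ₗ.[ℂ] H}
    (h : T.adjoint.graph = T.graph.topologicalClosure) (hS : S.graph = T.graph.topologicalClosure) :
    IsFriedrichsExtension T S := by
  refine ⟨hd, hs, hn, fun x w => ⟨fun hxw => ?_, fun hxw => ?_⟩⟩
  · rw [hS] at hxw
    obtain ⟨p, hp, hlim⟩ := mem_closure_iff_seq_limit.1 hxw
    have hp' : ∀ n, ∃ u : T.domain, (u : H) = (p n).1 ∧ T u = (p n).2 := fun n =>
      T.mem_graph_iff.1 (hp n)
    choose u hu1 hu2 using hp'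
    have h1 : Tendsto (fun n => (u n : H)) atTop (𝓝 x) :=
      ((continuous_fst.tendsto _).comp hlim).congr fun n => (hu1 n).symm
    have h2 : Tendsto (fun n => T (u n)) atTop (𝓝 w) :=
      ((continuous_snd.tendsto _).comp hlim).congr fun n => (hu2 n).symm
    have hx : x ∈ formDomain T := ⟨u, formTendsto_of_graph_tendsto h1 h2⟩
    exact ⟨hx, fun y hy => ⟨hx, hy, fun u' v hu' hv =>
      tendsto_form_of_graph_tendsto hs hn h1 h2 hu' hv⟩⟩
  · obtain ⟨⟨u, hu⟩, hval⟩ := hxw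
    rw [hS, ← h, LinearPMap.adjoint_graph_eq_graph_adjoint hd, Submodule.mem_adjoint_iff]
    intro a b hab
    obtain ⟨φ, rfl, rfl⟩ := T.mem_graph_iff.1 hab
    -- Testing against φ in the domain of T moves T onto φ, so x lies in the domain of T† with T† x
    -- = w.
    have h1 := (hval φ (mem_formDomain φ)).2.2 u (fun _ => φ) hu (formTendsto_const φ)
    have h2 : Tendsto (fun n => form T (u n) φ) atTop (𝓝 (inner ℂ (T φ) x)) := by
      have h3 : Tendsto (fun n => inner ℂ (T φ) (u n : H)) atTop (𝓝 (inner ℂ (T φ) x)) :=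
        tendsto_const_nhds.inner hu.1
      exact h3.congr fun n => hs φ (u n)
    exact sub_eq_zero.2 (tendsto_nhds_unique h2 h1)

end FormConvergence

/-! ### Calculus of L_γ: product rule, powers of x, monomials -/

theorem bdf_pos {z : ℂ} (hz : z ∈ ball (0 : ℂ) 1) : 0 < bdf z := by
  have hz1 : ‖z‖ < 1 := by simpa using hz
  unfold bdf; nlinarith [norm_nonneg z]

theorem contDiff_bdf {n : WithTop ℕ∞} : ContDiff ℝ n bdf := by
  unfold bdf
  exact contDiff_const.sub (contDiff_norm_sq ℝ)

theorem contDiffAt_fderiv {f : ℂ → ℂ} {z : ℂ} (hf : ContDiffAt ℝ ∞ f z) :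
    ContDiffAt ℝ ∞ (fderiv ℝ f) z :=
  hf.fderiv_right (by norm_cast)

/-- The second term arises because the vector field i z itself varies with z. -/
theorem fderiv_angular_apply {f : ℂ → ℂ} {z : ℂ} (hf : ContDiffAt ℝ ∞ f z) (v : ℂ) :
    fderiv ℝ (angular f) z v =
      fderiv ℝ (fderiv ℝ f) z v (Complex.I * z) + fderiv ℝ f z (Complex.I * v) := by
  have h2 : HasFDerivAt (fun y : ℂ => Complex.I * y)
      (ContinuousLinearMap.mul ℝ ℂ Complex.I) z :=
    (ContinuousLinearMap.mul ℝ ℂ Complex.I).hasFDerivAt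
  have h3 := ((contDiffAt_fderiv hf).differentiableAt (by simp)).hasFDerivAt.clm_apply h2
  have h4 : fderiv ℝ (angular f) z = _ := h3.fderiv
  rw [h4]
  simp only [add_apply, ContinuousLinearMap.comp_apply,
    ContinuousLinearMap.flip_apply, ContinuousLinearMap.mul_apply']
  ring

/-- `L_γ` in terms of the first and second Fréchet derivatives. -/
theorem diskOp_eq {γ : ℝ} {f : ℂ → ℂ} {z : ℂ} (hf : ContDiffAt ℝ ∞ f z) :
    diskOp γ f z = -(bdf z : ℂ) * (fderiv ℝ (fderiv ℝ f) z 1 1 +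
        fderiv ℝ (fderiv ℝ f) z Complex.I Complex.I)
      + ((2 + 2 * γ : ℝ) : ℂ) * fderiv ℝ f z z
      - (fderiv ℝ (fderiv ℝ f) z (Complex.I * z) (Complex.I * z) - fderiv ℝ f z z)
      + (((γ + 1) ^ 2 : ℝ) : ℂ) * f z := by
  have hA := fderiv_angular_apply hf (Complex.I * z)
  rw [← mul_assoc, Complex.I_mul_I, neg_one_mul, map_neg] at hA
  rw [diskOp, radial, angular, hA, InnerProductSpace.laplacian_eq_iteratedFDeriv_complexPlane]
  simp only [iteratedFDeriv_two_apply, Matrix.cons_val_zero, Matrix.cons_val_one]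
  ring

theorem fderiv_mul_apply {f g : ℂ → ℂ} {z : ℂ} (hf : ContDiffAt ℝ ∞ f z)
    (hg : ContDiffAt ℝ ∞ g z) (v : ℂ) :
    fderiv ℝ (fun y => f y * g y) z v = f z * fderiv ℝ g z v + g z * fderiv ℝ f z v := by
  have h := (hf.differentiableAt (by simp)).hasFDerivAt.mul
    (hg.differentiableAt (by simp)).hasFDerivAt
  have h' : fderiv ℝ (fun y => f y * g y) z = _ := h.fderiv
  rw [h']
  simp

theorem fderiv_fderiv_mul_apply {f g : ℂ → ℂ} {z : ℂ} (hf : ContDiffAt ℝ ∞ f z)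
    (hg : ContDiffAt ℝ ∞ g z) (v w : ℂ) :
    fderiv ℝ (fderiv ℝ (fun y => f y * g y)) z v w =
      f z * fderiv ℝ (fderiv ℝ g) z v w + fderiv ℝ f z v * fderiv ℝ g z w +
        g z * fderiv ℝ (fderiv ℝ f) z v w + fderiv ℝ g z v * fderiv ℝ f z w := by
  have hE : fderiv ℝ (fun y => f y * g y) =ᶠ[𝓝 z]
      fun y => f y • fderiv ℝ g y + g y • fderiv ℝ f y := by
    filter_upwards [eventually_contDiffAt hf, eventually_contDiffAt hg] with y h1 h2
    exact (h1.hasFDerivAt.mul h2.hasFDerivAt).fderiv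
  have hDf := ((contDiffAt_fderiv hf).differentiableAt (by simp)).hasFDerivAt
  have hDg := ((contDiffAt_fderiv hg).differentiableAt (by simp)).hasFDerivAt
  have h := ((hf.differentiableAt (by simp)).hasFDerivAt.smul hDg).add
    ((hg.differentiableAt (by simp)).hasFDerivAt.smul hDf)
  have h' : fderiv ℝ (fun y => f y • fderiv ℝ g y + g y • fderiv ℝ f y) z = _ := h.fderiv
  rw [hE.fderiv_eq, h']
  simp
  ring

/-- The Leibniz rule for `L_γ`. -/
theorem diskOp_mul {γ : ℝ} {f g : ℂ → ℂ} {z : ℂ} (hf : ContDiffAt ℝ ∞ f z)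
    (hg : ContDiffAt ℝ ∞ g z) :
    diskOp γ (fun y => f y * g y) z = f z * diskOp γ g z + g z * diskOp γ f z
      - (((γ + 1) ^ 2 : ℝ) : ℂ) * (f z * g z)
      - 2 * (bdf z : ℂ) * (fderiv ℝ f z 1 * fderiv ℝ g z 1 +
        fderiv ℝ f z Complex.I * fderiv ℝ g z Complex.I)
      - 2 * (fderiv ℝ f z (Complex.I * z) * fderiv ℝ g z (Complex.I * z)) := by
  rw [diskOp_eq (hf.mul hg), diskOp_eq hf, diskOp_eq hg]
  simp only [fderiv_fderiv_mul_apply hf hg, fderiv_mul_apply hf hg]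
  ring

theorem clm_apply_eq (A : ℂ →L[ℝ] ℂ) (v : ℂ) :
    A v = (v.re : ℂ) * A 1 + (v.im : ℂ) * A Complex.I := by
  have e : v = v.re • (1 : ℂ) + v.im • Complex.I := by simp [Complex.re_add_im]
  conv_lhs => rw [e]
  rw [map_add, map_smul, map_smul, Complex.real_smul, Complex.real_smul]

theorem bdf_eq (z : ℂ) : bdf z = 1 - (z.re ^ 2 + z.im ^ 2) := by
  rw [bdf, Complex.sq_norm, Complex.normSq_apply]; ring

theorem hasFDerivAt_bdf (z : ℂ) : HasFDerivAt bdf (-(2 : ℝ) • innerSL ℝ z) z := by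
  have h := (hasStrictFDerivAt_norm_sq z).hasFDerivAt.const_sub 1
  refine h.congr_fderiv ?_
  ext v
  simp
  ring

/-- The first derivative of a function of `x` alone, where `h' = h₁`. -/
theorem fderiv_comp_bdf {h h₁ : ℝ → ℝ} {z : ℂ} (h' : HasDerivAt h (h₁ (bdf z)) (bdf z)) (v : ℂ) :
    fderiv ℝ (fun y => (h (bdf y) : ℂ)) z v =
      -2 * (h₁ (bdf z) : ℂ) * (z.re * v.re + z.im * v.im) := by
  have h1 := (h'.hasFDerivAt.comp z (hasFDerivAt_bdf z))
  have h2 := Complex.ofRealCLM.hasFDerivAt.comp z h1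
  have h3 : fderiv ℝ (fun y => (h (bdf y) : ℂ)) z = _ := h2.fderiv
  rw [h3]
  simp [Complex.inner]
  ring

theorem fderiv_fderiv_comp_bdf {h h₁ h₂ : ℝ → ℝ} {z : ℂ}
    (h' : ∀ᶠ t in 𝓝 (bdf z), HasDerivAt h (h₁ t) t)
    (h'' : HasDerivAt h₁ (h₂ (bdf z)) (bdf z))
    (hc : ContDiffAt ℝ ∞ (fun y => (h (bdf y) : ℂ)) z) (v w : ℂ) :
    fderiv ℝ (fderiv ℝ (fun y => (h (bdf y) : ℂ))) z v w =
      4 * (h₂ (bdf z) : ℂ) * (z.re * v.re + z.im * v.im) * (z.re * w.re + z.im * w.im) -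
        2 * (h₁ (bdf z) : ℂ) * (v.re * w.re + v.im * w.im) := by
  -- The second derivative is read off by freezing w and differentiating the first-derivative
  -- formula in the direction v.
  have hE : (fun y => fderiv ℝ (fun y => (h (bdf y) : ℂ)) y w) =ᶠ[𝓝 z]
      fun y => -2 * (h₁ (bdf y) : ℂ) * ((Complex.reCLM y : ℝ) * w.re + (Complex.imCLM y : ℝ) * w.im) := by
    have := (contDiff_bdf (n := 1)).continuous.continuousAt.eventually h'
    filter_upwards [this] with y hy
    exact fderiv_comp_bdf hy w
  have hD := ((contDiffAt_fderiv hc).differentiableAt (by simp)).hasFDerivAt.clm_apply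
    (hasFDerivAt_const w z)
  have h1 : HasFDerivAt (fun y => (h₁ (bdf y) : ℂ)) _ z :=
    Complex.ofRealCLM.hasFDerivAt.comp z (h''.hasFDerivAt.comp z (hasFDerivAt_bdf z))
  have hre : HasFDerivAt (fun y : ℂ => ((Complex.reCLM y : ℝ) : ℂ)) _ z :=
    Complex.ofRealCLM.hasFDerivAt.comp z Complex.reCLM.hasFDerivAt
  have him : HasFDerivAt (fun y : ℂ => ((Complex.imCLM y : ℝ) : ℂ)) _ z :=
    Complex.ofRealCLM.hasFDerivAt.comp z Complex.imCLM.hasFDerivAt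
  have h2 := (h1.const_mul (-2)).mul ((hre.mul_const (w.re : ℂ)).add (him.mul_const (w.im : ℂ)))
  have h3 := congrArg (fun A : ℂ →L[ℝ] ℂ => A v) ((hD.congr_of_eventuallyEq hE.symm).unique h2)
  simp [Complex.inner] at h3
  rw [h3]
  ring

/-- The action of `L_γ` on the product of a function of `x` and a smooth function. -/
theorem diskOp_comp_bdf_mul {γ : ℝ} {h h₁ h₂ : ℝ → ℝ} {g : ℂ → ℂ} {z : ℂ}
    (h' : ∀ᶠ t in 𝓝 (bdf z), HasDerivAt h (h₁ t) t)
    (h'' : HasDerivAt h₁ (h₂ (bdf z)) (bdf z))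
    (hc : ContDiffAt ℝ ∞ (fun y => (h (bdf y) : ℂ)) z) (hg : ContDiffAt ℝ ∞ g z) :
    diskOp γ (fun y => (h (bdf y) : ℂ) * g y) z = (h (bdf z) : ℂ) * diskOp γ g z
      + ((-4 * bdf z * (1 - bdf z) * h₂ (bdf z) + 4 * bdf z * h₁ (bdf z)
        - 4 * (1 + γ) * (1 - bdf z) * h₁ (bdf z) : ℝ) : ℂ) * g z
      + ((4 * bdf z * h₁ (bdf z) : ℝ) : ℂ) * radial g z := by
  rw [diskOp_mul hc hg, diskOp_eq hc]
  simp only [fderiv_fderiv_comp_bdf h' h'' hc, fderiv_comp_bdf h'.self_of_nhds, radial]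
  rw [clm_apply_eq (fderiv ℝ g z) z, clm_apply_eq (fderiv ℝ g z) (Complex.I * z)]
  simp only [bdf_eq]
  simp
  ring

theorem contDiffAt_comp_bdf {h : ℝ → ℝ} {z : ℂ} (hh : ContDiffAt ℝ ∞ h (bdf z)) :
    ContDiffAt ℝ ∞ (fun y => (h (bdf y) : ℂ)) z :=
  Complex.ofRealCLM.contDiff.contDiffAt.comp z (hh.comp z contDiff_bdf.contDiffAt)

/-- Multiplication by `x^{-γ}` intertwines `L_{-γ}` and `L_γ`. -/
theorem diskOp_rpow_mul {γ : ℝ} {g : ℂ → ℂ} {z : ℂ} (hz : z ∈ ball (0 : ℂ) 1)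
    (hg : ContDiffAt ℝ ∞ g z) :
    diskOp γ (fun y => ((bdf y ^ (-γ) : ℝ) : ℂ) * g y) z =
      ((bdf z ^ (-γ) : ℝ) : ℂ) * diskOp (-γ) g z := by
  have hx := bdf_pos hz
  have hp : ∀ (p : ℝ) {t : ℝ}, 0 < t → HasDerivAt (fun t : ℝ => t ^ p) (p * t ^ (p - 1)) t :=
    fun p t ht => Real.hasDerivAt_rpow_const (Or.inl ht.ne')
  rw [diskOp_comp_bdf_mul (h := fun t => t ^ (-γ)) (h₁ := fun t => -γ * t ^ (-γ - 1))
    (h₂ := fun t => -γ * ((-γ - 1) * t ^ (-γ - 1 - 1)))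
    ((lt_mem_nhds hx).mono fun t ht => hp _ ht) ((hp _ hx).const_mul _)
    (contDiffAt_comp_bdf (h := fun t => t ^ (-γ)) (Real.contDiffAt_rpow_const_of_ne hx.ne')) hg]
  -- The terms of order x^{-γ-1} cancel. What remains shifts both 2 + 2γ and (γ + 1)² by -4γ, which
  -- is exactly the change from γ to -γ.
  have e1 : bdf z ^ (-γ - 1) = bdf z ^ (-γ) / bdf z := Real.rpow_sub_one hx.ne' _
  have e2 : bdf z ^ (-γ - 1 - 1) = bdf z ^ (-γ) / bdf z / bdf z := by
    rw [Real.rpow_sub_one hx.ne', e1]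
  simp only [e1, e2, diskOp]
  have hne : (bdf z : ℂ) ≠ 0 := by exact_mod_cast hx.ne'
  generalize bdf z ^ (-γ) = X
  push_cast
  field_simp
  ring

/-- `L_γ` acts triangularly on the monomials `z^a z̄^b`. -/
theorem diskOp_monomial (γ : ℝ) (a b : ℕ) (z : ℂ) :
    diskOp γ (fun y => y ^ a * conj y ^ b) z =
      -(4 * a * b : ℂ) * (z ^ (a - 1) * conj z ^ (b - 1)) +
        (((a + b + γ + 1) ^ 2 : ℝ) : ℂ) * (z ^ a * conj z ^ b) := by
  have hcf : ∀ a : ℕ, ContDiff ℝ ∞ fun y : ℂ => y ^ a := fun a => contDiff_id.pow a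
  have hcg : ∀ b : ℕ, ContDiff ℝ ∞ fun y : ℂ => conj y ^ b :=
    fun b => (Complex.conjCLE.contDiff).pow b
  have hf : ∀ (a : ℕ) (z : ℂ), HasFDerivAt (fun y : ℂ => y ^ a)
      (((a : ℂ) * z ^ (a - 1)) • (ContinuousLinearMap.id ℝ ℂ)) z := by
    intro a z
    refine ((hasFDerivAt_id (𝕜 := ℝ) z).pow a).congr_fderiv ?_
    ext v
    simp
  have hg : ∀ (b : ℕ) (z : ℂ), HasFDerivAt (fun y : ℂ => conj y ^ b)
      (((b : ℂ) * conj z ^ (b - 1)) • (Complex.conjCLE : ℂ →L[ℝ] ℂ)) z := by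
    intro b z
    refine ((Complex.conjCLE.hasFDerivAt (x := z)).pow b).congr_fderiv ?_
    ext v
    simp
  have hf2 : ∀ v w : ℂ, fderiv ℝ (fderiv ℝ fun y : ℂ => y ^ a) z v w =
      (a : ℂ) * ((a - 1 : ℕ) * z ^ (a - 1 - 1)) * v * w := by
    intro v w
    have h1 : (fderiv ℝ fun y : ℂ => y ^ a) =
        fun y => ((a : ℂ) * y ^ (a - 1)) • (ContinuousLinearMap.id ℝ ℂ) :=
      funext fun y => (hf a y).fderiv
    rw [h1, (((hf (a - 1) z).const_mul (a : ℂ)).smul_const _).fderiv]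
    simp
    left
    ring
  have hg2 : ∀ v w : ℂ, fderiv ℝ (fderiv ℝ fun y : ℂ => conj y ^ b) z v w =
      (b : ℂ) * ((b - 1 : ℕ) * conj z ^ (b - 1 - 1)) * conj v * conj w := by
    intro v w
    have h1 : (fderiv ℝ fun y : ℂ => conj y ^ b) =
        fun y => ((b : ℂ) * conj y ^ (b - 1)) • (Complex.conjCLE : ℂ →L[ℝ] ℂ) :=
      funext fun y => (hg b y).fderiv
    rw [h1, (((hg (b - 1) z).const_mul (b : ℂ)).smul_const _).fderiv]
    simp
    left
    ring
  have hx : (bdf z : ℂ) = 1 - z * conj z := by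
    rw [bdf, Complex.mul_conj, Complex.normSq_eq_norm_sq]; simp
  -- The truncated exponents a - 1 and a - 2 do no harm: the coefficients a and a (a - 1) vanish
  -- whenever truncation occurs.
  have pz : ∀ (a : ℕ) (y : ℂ), (a : ℂ) * y ^ a = a * y ^ (a - 1) * y := by
    intro a y
    cases a with
    | zero => simp
    | succ n => simp [pow_succ, mul_assoc]
  have pz2 : ∀ (a : ℕ) (y : ℂ), (a : ℂ) * ((a - 1 : ℕ) * y ^ (a - 1 - 1)) * y * y =
      a * (a - 1) * y ^ a := by
    intro a y
    rcases a with _ | _ | n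
    · simp
    · simp
    · simp [pow_succ]; ring
  rw [diskOp_mul (hcf a).contDiffAt (hcg b).contDiffAt, diskOp_eq (hcf a).contDiffAt,
    diskOp_eq (hcg b).contDiffAt, hx]
  simp only [hf2, hg2, (hf a z).fderiv, (hg b z).fderiv]
  simp
  have i2 := Complex.I_mul_I
  have q1 := pz a z
  have q2 := pz b (conj z)
  have q3 := pz2 a z
  have q4 := pz2 b (conj z)
  set p := (a : ℂ) * z ^ (a - 1) with hp
  set q := (b : ℂ) * conj z ^ (b - 1) with hq
  have hpq : 4 * (a : ℂ) * b * (z ^ (a - 1) * conj z ^ (b - 1)) = 4 * p * q := by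
    rw [hp, hq]; ring
  rw [hpq]
  clear_value p q
  generalize (a : ℂ) * ((a - 1 : ℕ) * z ^ (a - 1 - 1)) = P at *
  generalize (b : ℂ) * ((b - 1 : ℕ) * conj z ^ (b - 1 - 1)) = Q at *
  generalize z ^ a = X at *
  generalize conj z ^ b = Y at *
  generalize conj z = c at *
  linear_combination (X * (z * c - 1) * Q - X * Q * c ^ 2 + Y * (z * c - 1) * P - Y * P * z ^ 2
    + 2 * (1 - z * c) * p * q + 2 * p * z * q * c) * i2 + X * q4 + Y * q3
    - (3 + 2 * γ) * X * q2 - (3 + 2 * γ) * Y * q1 - 2 * (q1 * b * Y + p * z * q2)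

/-! ### The weighted measure x^γ dV -/

section Measure

theorem measurable_density (γ : ℝ) : Measurable fun z : ℂ => ENNReal.ofReal (bdf z ^ γ) := by
  unfold bdf; fun_prop

theorem ae_mem_ball (γ : ℝ) : ∀ᵐ z ∂diskMeasure γ, z ∈ ball (0 : ℂ) 1 :=
  (ae_diskMeasure_iff γ _).2 (ae_restrict_mem measurableSet_ball)

theorem toReal_density {γ : ℝ} {z : ℂ} (hz : z ∈ ball (0 : ℂ) 1) :
    (ENNReal.ofReal (bdf z ^ γ)).toReal = bdf z ^ γ :=
  ENNReal.toReal_ofReal (Real.rpow_nonneg (bdf_pos hz).le _)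

theorem integral_diskMeasure {E : Type*} [NormedAddCommGroup E] [NormedSpace ℝ E]
    (γ : ℝ) (h : ℂ → E) :
    ∫ z, h z ∂diskMeasure γ = ∫ z in ball (0 : ℂ) 1, bdf z ^ γ • h z := by
  rw [diskMeasure, integral_withDensity_eq_integral_toReal_smul (measurable_density γ)
    (Eventually.of_forall fun _ => ENNReal.ofReal_lt_top)]
  exact setIntegral_congr_fun measurableSet_ball fun z hz => by
    simp only [toReal_density hz]

theorem integrable_diskMeasure_iff {E : Type*} [NormedAddCommGroup E] [NormedSpace ℝ E]
    (γ : ℝ) (h : ℂ → E) :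
    Integrable h (diskMeasure γ) ↔ IntegrableOn (fun z => bdf z ^ γ • h z) (ball 0 1) := by
  rw [diskMeasure, integrable_withDensity_iff_integrable_smul' (measurable_density γ)
    (Eventually.of_forall fun _ => ENNReal.ofReal_lt_top)]
  exact integrableOn_congr_fun (fun z hz => by simp only [toReal_density hz]) measurableSet_ball

theorem aestronglyMeasurable_diskMeasure {γ : ℝ} {h : ℂ → ℂ} (hc : ContinuousOn h (ball 0 1)) :
    AEStronglyMeasurable h (diskMeasure γ) :=
  (hc.aestronglyMeasurable measurableSet_ball).mono_ac (withDensity_absolutelyContinuous _ _)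

theorem continuous_of_continuousOn_ball {h : ℂ → ℂ} (hc : ContinuousOn h (ball 0 1))
    (hs : tsupport h ⊆ ball 0 1) : Continuous h :=
  continuous_of_tsupport fun _ hz => hc.continuousAt (isOpen_ball.mem_nhds (hs hz))

theorem contDiffAt_rpow_bdf (γ : ℝ) {z : ℂ} (hz : z ∈ ball (0 : ℂ) 1) :
    ContDiffAt ℝ ∞ (fun y => ((bdf y ^ γ : ℝ) : ℂ)) z :=
  contDiffAt_comp_bdf (h := fun t => t ^ γ)
    (Real.contDiffAt_rpow_const_of_ne (bdf_pos hz).ne')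

theorem hasCompactSupport_of_tsupport_subset {f g : ℂ → ℂ} (hf : HasCompactSupport f)
    (h : tsupport g ⊆ tsupport f) : HasCompactSupport g :=
  hf.of_isClosed_subset (isClosed_tsupport g) h

/-- The weight can be singular only at the circle, so its product with such a function is continuous
with compact support. -/
theorem integrable_diskMeasure_of_tsupport {γ : ℝ} {h : ℂ → ℂ} (hc : ContinuousOn h (ball 0 1))
    (hs : HasCompactSupport h) (hs' : tsupport h ⊆ ball 0 1) : Integrable h (diskMeasure γ) := by
  rw [integrable_diskMeasure_iff]
  have h1 : tsupport (fun z => bdf z ^ γ • h z) ⊆ tsupport h :=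
    closure_mono fun z hz h0 => hz (by simp [h0])
  have h2 : ContinuousOn (fun z => bdf z ^ γ • h z) (ball 0 1) := by
    intro z hz
    have h3 := (contDiffAt_rpow_bdf γ hz).continuousAt.continuousWithinAt.mul (hc z hz)
    simpa [Pi.mul_def] using h3
  exact ((continuous_of_continuousOn_ball h2 (h1.trans hs')).integrable_of_hasCompactSupport
    (hasCompactSupport_of_tsupport_subset hs h1)).integrableOn

theorem memLp_of_tsupport {γ : ℝ} {h : ℂ → ℂ} (hc : ContinuousOn h (ball 0 1))
    (hs : HasCompactSupport h) (hs' : tsupport h ⊆ ball 0 1) : MemLp h 2 (diskMeasure γ) := by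
  rw [memLp_two_iff_integrable_sq_norm (aestronglyMeasurable_diskMeasure hc)]
  have hsub : Function.support (fun z => h z * conj (h z)) ⊆ Function.support h :=
    fun z hz h0 => hz (by simp [h0])
  have h1 : Integrable (fun z => h z * conj (h z)) (diskMeasure γ) :=
    integrable_diskMeasure_of_tsupport (hc.mul (Complex.continuous_conj.comp_continuousOn hc))
      (hs.mono hsub) ((closure_mono hsub).trans hs')
  refine h1.norm.congr (Eventually.of_forall fun z => ?_)
  simp [sq]

end Measure

/-! ### Smooth functions and the support of L_γ f -/

section Smooth

theorem continuousOn_diskOp {γ : ℝ} {f : ℂ → ℂ} (hf : f ∈ smoothInterior) :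
    ContinuousOn (diskOp γ f) (ball 0 1) := by
  have h0 : ContDiffOn ℝ ∞ f (ball 0 1) := hf
  have h1 : ContDiffOn ℝ ∞ (fderiv ℝ f) (ball 0 1) :=
    h0.fderiv_of_isOpen isOpen_ball (by norm_cast)
  have h2 : ContDiffOn ℝ ∞ (fderiv ℝ (fderiv ℝ f)) (ball 0 1) :=
    h1.fderiv_of_isOpen isOpen_ball (by norm_cast)
  have c0 := h0.continuousOn
  have c1 := h1.continuousOn
  have c2 := h2.continuousOn
  have cb : Continuous bdf := (contDiff_bdf (n := 1)).continuous
  refine ContinuousOn.congr ?_ fun z hz => diskOp_eq (contDiffAt_of_mem hf hz)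
  fun_prop

theorem diskOp_congr {γ : ℝ} {f g : ℂ → ℂ} {z : ℂ} (h : f =ᶠ[𝓝 z] g) :
    diskOp γ f z = diskOp γ g z := by
  have hE : angular f =ᶠ[𝓝 z] angular g := by
    filter_upwards [h.eventuallyEq_nhds] with y hy
    simp [angular, hy.fderiv_eq]
  have hA : angular (angular f) z = angular (angular g) z := by
    rw [angular, hE.fderiv_eq]; rfl
  have hR : radial f z = radial g z := by rw [radial, h.fderiv_eq]; rfl
  simp only [diskOp, hA, hR, h.eq_of_nhds,
    (InnerProductSpace.laplacian_congr_nhds h).eq_of_nhds]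

theorem tsupport_diskOp_subset (γ : ℝ) (f : ℂ → ℂ) : tsupport (diskOp γ f) ⊆ tsupport f := by
  refine closure_minimal (fun z hz => ?_) (isClosed_tsupport f)
  by_contra h
  exact hz (diskOp_eq_zero γ (notMem_tsupport_iff_eventuallyEq.1 h))

theorem contDiff_of_contDiffAt_tsupport {f : ℂ → ℂ} (h : ∀ z ∈ tsupport f, ContDiffAt ℝ ∞ f z) :
    ContDiff ℝ ∞ f := by
  rw [contDiff_iff_contDiffAt]
  intro z
  by_cases hz : z ∈ tsupport f
  · exact h z hz
  · exact (contDiffAt_const (c := (0 : ℂ))).congr_of_eventuallyEq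
      (notMem_tsupport_iff_eventuallyEq.1 hz)

/-- No regularity of the first factor at the circle is needed, so it may be a power of x. -/
theorem mul_mem_smoothCompact {f g : ℂ → ℂ} (hf : f ∈ smoothInterior) (hg : g ∈ smoothCompact) :
    (fun z => f z * g z) ∈ smoothCompact := by
  have hs : tsupport (fun z => f z * g z) ⊆ tsupport g :=
    closure_mono (Function.support_mul_subset_right _ _)
  exact ⟨contDiff_of_contDiffAt_tsupport fun z hz =>
      (contDiffAt_of_mem hf (hg.2.2 (hs hz))).mul hg.1.contDiffAt,
    hasCompactSupport_of_tsupport_subset hg.2.1 hs, hs.trans hg.2.2⟩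

theorem conj_mem_smoothCompact {g : ℂ → ℂ} (hg : g ∈ smoothCompact) :
    (fun z => conj (g z)) ∈ smoothCompact := by
  have hs : tsupport (fun z => conj (g z)) ⊆ tsupport g :=
    closure_mono fun z hz h0 => hz (by simp [h0])
  exact ⟨Complex.conjCLE.contDiff.comp hg.1, hasCompactSupport_of_tsupport_subset hg.2.1 hs,
    hs.trans hg.2.2⟩

theorem fderiv_conj_apply {g : ℂ → ℂ} {z : ℂ} (hg : DifferentiableAt ℝ g z) (v : ℂ) :
    fderiv ℝ (fun y => conj (g y)) z v = conj (fderiv ℝ g z v) := by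
  have h : fderiv ℝ (fun y => conj (g y)) z = _ :=
    (Complex.conjCLE.hasFDerivAt.comp z hg.hasFDerivAt).fderiv
  rw [h]
  simp

theorem rpow_mem_smoothInterior (γ : ℝ) :
    (fun y => ((bdf y ^ γ : ℝ) : ℂ)) ∈ smoothInterior :=
  fun _ hz => (contDiffAt_rpow_bdf γ hz).contDiffWithinAt

theorem memLp_smoothCompact {γ : ℝ} {f : ℂ → ℂ} (hf : f ∈ smoothCompact) :
    MemLp f 2 (diskMeasure γ) :=
  memLp_of_tsupport hf.1.continuous.continuousOn hf.2.1 hf.2.2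

theorem memLp_diskOp_smoothCompact {γ : ℝ} {f : ℂ → ℂ} (hf : f ∈ smoothCompact) :
    MemLp (diskOp γ f) 2 (diskMeasure γ) :=
  memLp_of_tsupport (continuousOn_diskOp (smoothCompact_le hf))
    (hasCompactSupport_of_tsupport_subset hf.2.1 (tsupport_diskOp_subset γ f))
    ((tsupport_diskOp_subset γ f).trans hf.2.2)

end Smooth

/-! ### Green's formula and formal symmetry -/

section Green

/-- The density of the Dirichlet form of `L_γ`. -/
noncomputable def dirichletDensity (γ : ℝ) (f g : ℂ → ℂ) (z : ℂ) : ℂ :=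
  (bdf z : ℂ) * (fderiv ℝ f z 1 * conj (fderiv ℝ g z 1) +
      fderiv ℝ f z Complex.I * conj (fderiv ℝ g z Complex.I)) +
    fderiv ℝ f z (Complex.I * z) * conj (fderiv ℝ g z (Complex.I * z)) +
    (((γ + 1) ^ 2 : ℝ) : ℂ) * (f z * conj (g z))

theorem integral_fderiv_eq_zero {F : ℂ → ℂ} (hF : ContDiff ℝ 1 F) (hs : HasCompactSupport F)
    (v : ℂ) : ∫ z, fderiv ℝ F z v = 0 := by
  have hc : Continuous fun z => fderiv ℝ F z v :=
    (hF.continuous_fderiv (by simp)).clm_apply continuous_const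
  have h1 : Integrable (fun z => fderiv ℝ F z v) :=
    hc.integrable_of_hasCompactSupport (hs.fderiv_apply ℝ v)
  have h2 : Integrable F := hF.continuous.integrable_of_hasCompactSupport hs
  have h := integral_mul_fderiv_eq_neg_fderiv_mul_of_integrable (𝕜 := ℂ) (μ := (volume : Measure ℂ))
    (f := fun _ => (1 : ℂ)) (g := F) (v := v) (by simp) (by simpa using h1) (by simpa using h2)
    (fun _ _ => differentiableAt_const _) (fun z _ => hF.differentiable (by simp) z)
  simpa using h

theorem fderiv_rpow_bdf (γ : ℝ) {z : ℂ} (hz : z ∈ ball (0 : ℂ) 1) (v : ℂ) :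
    fderiv ℝ (fun y => ((bdf y ^ γ : ℝ) : ℂ)) z v =
      -2 * ((γ * bdf z ^ (γ - 1) : ℝ) : ℂ) * (z.re * v.re + z.im * v.im) :=
  fderiv_comp_bdf (h := fun t => t ^ γ) (h₁ := fun t => γ * t ^ (γ - 1))
    (Real.hasDerivAt_rpow_const (Or.inl (bdf_pos hz).ne')) v

/-- L_γ has divergence form: L_γ f = -x^{-γ} div(x^γ W) + (γ + 1)² f with W = x ∇f + (∂_ω f) i z.
The angular term commutes with the weight because x is rotation invariant. Integration by parts
against a compactly supported g leaves no boundary term. -/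
theorem integral_diskOp_mul_conj {γ : ℝ} {f g : ℂ → ℂ} (hf : f ∈ smoothCompact)
    (hg : g ∈ smoothCompact) :
    ∫ z, diskOp γ f z * conj (g z) ∂diskMeasure γ = ∫ z, dirichletDensity γ f g z ∂diskMeasure γ := by
  have hg' := conj_mem_smoothCompact hg
  set c : ℂ → ℂ := fun z => ((bdf z ^ γ : ℝ) : ℂ) * conj (g z) with hc
  have hcs : c ∈ smoothCompact := mul_mem_smoothCompact (rpow_mem_smoothInterior γ) hg'
  have h1 : ContDiff ℝ ∞ (fderiv ℝ f) := hf.1.fderiv_right (by norm_cast)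
  have hx : ContDiff ℝ ∞ fun z => (bdf z : ℂ) := Complex.ofRealCLM.contDiff.comp contDiff_bdf
  have hre : ContDiff ℝ ∞ fun z : ℂ => (z.re : ℂ) :=
    Complex.ofRealCLM.contDiff.comp Complex.reCLM.contDiff
  have him : ContDiff ℝ ∞ fun z : ℂ => (z.im : ℂ) :=
    Complex.ofRealCLM.contDiff.comp Complex.imCLM.contDiff
  have hd : ∀ v : ℂ, ContDiff ℝ ∞ fun z => fderiv ℝ f z v := fun v => h1.clm_apply contDiff_const
  have ha : ContDiff ℝ ∞ (angular f) := h1.clm_apply (contDiff_const.mul contDiff_id)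
  -- p and q are the Cartesian components of W; below, (P, Q) is the field x^γ ḡ W, whose divergence
  -- is computed in `hpt`.
  set p : ℂ → ℂ := fun z => (bdf z : ℂ) * fderiv ℝ f z 1 - (z.im : ℂ) * angular f z with hp
  set q : ℂ → ℂ := fun z => (bdf z : ℂ) * fderiv ℝ f z Complex.I + (z.re : ℂ) * angular f z with hq
  have hpc : ContDiff ℝ ∞ p := (hx.mul (hd _)).sub (him.mul ha)
  have hqc : ContDiff ℝ ∞ q := (hx.mul (hd _)).add (hre.mul ha)
  have hP := mul_mem_smoothCompact (f := p) hpc.contDiffOn hcs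
  have hQ := mul_mem_smoothCompact (f := q) hqc.contDiffOn hcs
  set P : ℂ → ℂ := fun z => p z * c z with hPdef
  set Q : ℂ → ℂ := fun z => q z * c z with hQdef
  have hzero : ∀ (F : ℂ → ℂ), F ∈ smoothCompact → ∀ v : ℂ, Integrable (fun z => fderiv ℝ F z v) ∧
      ∫ z in ball (0 : ℂ) 1, fderiv ℝ F z v = 0 := by
    intro F hF v
    have hF1 : ContDiff ℝ 1 F := hF.1.of_le (by norm_cast)
    refine ⟨((hF1.continuous_fderiv (by simp)).clm_apply
      continuous_const).integrable_of_hasCompactSupport (hF.2.1.fderiv_apply ℝ v), ?_⟩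
    rw [setIntegral_eq_integral_of_forall_compl_eq_zero, integral_fderiv_eq_zero hF1 hF.2.1]
    intro z hz
    have : z ∉ tsupport F := fun h => hz (hF.2.2 h)
    rw [(notMem_tsupport_iff_eventuallyEq.1 this).fderiv_eq]
    simp
  have hpt : ∀ z ∈ ball (0 : ℂ) 1, bdf z ^ γ • (dirichletDensity γ f g z - diskOp γ f z * conj (g z)) =
      fderiv ℝ P z 1 + fderiv ℝ Q z Complex.I := by
    intro z hz
    have hfz := hf.1.contDiffAt (x := z)
    have hxz : ∀ v, fderiv ℝ (fun y => (bdf y : ℂ)) z v = -2 * (z.re * v.re + z.im * v.im) := by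
      intro v
      simpa using fderiv_comp_bdf (z := z) (h := id) (h₁ := fun _ => 1) (hasDerivAt_id _) v
    have hrez : ∀ v, fderiv ℝ (fun y : ℂ => (y.re : ℂ)) z v = v.re := fun v => by
      have h : fderiv ℝ (fun y : ℂ => (y.re : ℂ)) z = _ :=
        (Complex.ofRealCLM.hasFDerivAt.comp z Complex.reCLM.hasFDerivAt).fderiv
      rw [h]; simp
    have himz : ∀ v, fderiv ℝ (fun y : ℂ => (y.im : ℂ)) z v = v.im := fun v => by
      have h : fderiv ℝ (fun y : ℂ => (y.im : ℂ)) z = _ :=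
        (Complex.ofRealCLM.hasFDerivAt.comp z Complex.imCLM.hasFDerivAt).fderiv
      rw [h]; simp
    have hdz : ∀ w v, fderiv ℝ (fun y => fderiv ℝ f y w) z v = fderiv ℝ (fderiv ℝ f) z v w := by
      intro w v
      have h : fderiv ℝ (fun y => fderiv ℝ f y w) z = _ :=
        (((h1.differentiable (by simp)) z).hasFDerivAt.clm_apply (hasFDerivAt_const w z)).fderiv
      rw [h]; simp
    have hpz : ∀ v, fderiv ℝ p z v = (bdf z : ℂ) * fderiv ℝ (fderiv ℝ f) z v 1
        - 2 * (z.re * v.re + z.im * v.im) * fderiv ℝ f z 1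
        - ((z.im : ℂ) * fderiv ℝ (angular f) z v + (v.im : ℂ) * angular f z) := by
      intro v
      have hsub : fderiv ℝ p z = _ := HasFDerivAt.fderiv
        (((hx.mul (hd 1)).differentiable (by simp) z).hasFDerivAt.sub
          ((him.mul ha).differentiable (by simp) z).hasFDerivAt)
      rw [hsub]
      simp only [sub_apply]
      rw [fderiv_mul_apply hx.contDiffAt (hd _).contDiffAt,
        fderiv_mul_apply him.contDiffAt ha.contDiffAt, hxz, himz, hdz]
      ring
    have hqz : ∀ v, fderiv ℝ q z v = (bdf z : ℂ) * fderiv ℝ (fderiv ℝ f) z v Complex.I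
        - 2 * (z.re * v.re + z.im * v.im) * fderiv ℝ f z Complex.I
        + ((z.re : ℂ) * fderiv ℝ (angular f) z v + (v.re : ℂ) * angular f z) := by
      intro v
      have hsub : fderiv ℝ q z = _ := HasFDerivAt.fderiv
        (((hx.mul (hd Complex.I)).differentiable (by simp) z).hasFDerivAt.add
          ((hre.mul ha).differentiable (by simp) z).hasFDerivAt)
      rw [hsub]
      simp only [add_apply]
      rw [fderiv_mul_apply hx.contDiffAt (hd _).contDiffAt,
        fderiv_mul_apply hre.contDiffAt ha.contDiffAt, hxz, hrez, hdz]
      ring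
    have hcz : ∀ v, fderiv ℝ c z v = ((bdf z ^ γ : ℝ) : ℂ) * conj (fderiv ℝ g z v) + conj (g z) *
        (-2 * ((γ * bdf z ^ (γ - 1) : ℝ) : ℂ) * (z.re * v.re + z.im * v.im)) := by
      intro v
      rw [hc, fderiv_mul_apply (contDiffAt_rpow_bdf γ hz) hg'.1.contDiffAt, fderiv_rpow_bdf γ hz,
        fderiv_conj_apply (hg.1.differentiable (by simp) z)]
    rw [hPdef, hQdef, fderiv_mul_apply hpc.contDiffAt hcs.1.contDiffAt,
      fderiv_mul_apply hqc.contDiffAt hcs.1.contDiffAt, hpz, hqz, hcz, hcz,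
      fderiv_angular_apply hfz, fderiv_angular_apply hfz, dirichletDensity, diskOp_eq hfz]
    simp only [hp, hq, hc, angular]
    have e1 : bdf z ^ (γ - 1) = bdf z ^ γ / bdf z :=
      Real.rpow_sub_one (bdf_pos hz).ne' _
    have hne : (bdf z : ℂ) ≠ 0 := by exact_mod_cast (bdf_pos hz).ne'
    rw [e1]
    have e : Complex.I * z = (-z.im) • (1 : ℂ) + z.re • Complex.I := by
      apply Complex.ext <;> simp
    have hB : ∀ w, fderiv ℝ (fderiv ℝ f) z (Complex.I * z) w =
        -z.im * fderiv ℝ (fderiv ℝ f) z 1 w + z.re * fderiv ℝ (fderiv ℝ f) z Complex.I w := by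
      intro w
      rw [e, map_add, map_smul, map_smul]
      simp
    rw [hB, clm_apply_eq (fderiv ℝ f z) z, clm_apply_eq (fderiv ℝ f z) (Complex.I * z),
      clm_apply_eq (fderiv ℝ g z) (Complex.I * z), Complex.real_smul]
    simp
    generalize bdf z ^ γ = X
    field_simp
    ring
  have hI1 : Integrable (fun z => diskOp γ f z * conj (g z)) (diskMeasure γ) := by
    have hs : tsupport (fun z => diskOp γ f z * conj (g z)) ⊆ tsupport fun z => conj (g z) :=
      closure_mono (Function.support_mul_subset_right _ _)
    exact integrable_diskMeasure_of_tsupport ((continuousOn_diskOp (smoothCompact_le hf)).mul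
      hg'.1.continuous.continuousOn) (hasCompactSupport_of_tsupport_subset hg'.2.1 hs)
      (hs.trans hg'.2.2)
  have hI2 : Integrable (dirichletDensity γ f g) (diskMeasure γ) := by
    have hs : tsupport (dirichletDensity γ f g) ⊆ tsupport f := by
      refine closure_minimal (fun z hz => ?_) (isClosed_tsupport f)
      by_contra h
      have h0 := notMem_tsupport_iff_eventuallyEq.1 h
      refine hz ?_
      simp [dirichletDensity, h0.fderiv_eq, h0.eq_of_nhds]
    have c0 := hf.1.continuous
    have c1 := h1.continuous
    have c2 := hg.1.continuous
    have c3 : Continuous (fderiv ℝ g) := hg.1.continuous_fderiv (by simp)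
    have c4 := hx.continuous
    have c5 : Continuous (dirichletDensity γ f g) := by
      unfold dirichletDensity
      have := Complex.continuous_conj
      fun_prop
    exact integrable_diskMeasure_of_tsupport c5.continuousOn
      (hasCompactSupport_of_tsupport_subset hf.2.1 hs) (hs.trans hf.2.2)
  have hmain : ∫ z, (dirichletDensity γ f g z - diskOp γ f z * conj (g z)) ∂diskMeasure γ = 0 := by
    rw [integral_diskMeasure, setIntegral_congr_fun measurableSet_ball hpt,
      integral_add (hzero P hP 1).1.integrableOn (hzero Q hQ Complex.I).1.integrableOn,
      (hzero P hP 1).2, (hzero Q hQ Complex.I).2, add_zero]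
  rw [integral_sub hI2 hI1, sub_eq_zero] at hmain
  exact hmain.symm

theorem conj_dirichletDensity (γ : ℝ) (f g : ℂ → ℂ) (z : ℂ) :
    conj (dirichletDensity γ f g z) = dirichletDensity γ g f z := by
  simp [dirichletDensity]
  ring

theorem re_dirichletDensity_nonneg (γ : ℝ) (f : ℂ → ℂ) {z : ℂ} (hz : z ∈ ball (0 : ℂ) 1) :
    0 ≤ (dirichletDensity γ f f z).re := by
  have hx := (bdf_pos hz).le
  have h : dirichletDensity γ f f z = ((bdf z * (‖fderiv ℝ f z 1‖ ^ 2 +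
      ‖fderiv ℝ f z Complex.I‖ ^ 2) + ‖fderiv ℝ f z (Complex.I * z)‖ ^ 2 +
      (γ + 1) ^ 2 * ‖f z‖ ^ 2 : ℝ) : ℂ) := by
    simp only [dirichletDensity, Complex.mul_conj, Complex.normSq_eq_norm_sq]
    push_cast
    ring
  rw [h, Complex.ofReal_re]
  positivity

/-- The Dirichlet density is Hermitian, so Green's formula may be applied on either side. -/
theorem integral_diskOp_mul_conj_comm_of_compact {γ : ℝ} {f g : ℂ → ℂ} (hf : f ∈ smoothCompact)
    (hg : g ∈ smoothCompact) :
    ∫ z, diskOp γ f z * conj (g z) ∂diskMeasure γ = ∫ z, f z * conj (diskOp γ g z) ∂diskMeasure γ := by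
  have h := congrArg conj (integral_diskOp_mul_conj (γ := γ) hg hf)
  rw [← integral_conj, ← integral_conj] at h
  simp only [conj_dirichletDensity] at h
  rw [integral_diskOp_mul_conj hf hg, ← h]
  simp [mul_comm]

theorem exists_cutoff {g : ℂ → ℂ} (hg : g ∈ smoothCompact) :
    ∃ χ ∈ smoothCompact, ∀ z ∈ tsupport g, χ =ᶠ[𝓝 z] 1 := by
  obtain ⟨r, hr, hsub⟩ := exists_lt_subset_ball (isClosed_tsupport g) hg.2.2
  -- The maximum with 1/2 keeps the inner radius of the bump positive, since r may fail to be.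
  set R : ℝ := max r (1 / 2) with hR
  have hR0 : 0 < R := lt_max_of_lt_right (by norm_num)
  have hR1 : R < 1 := max_lt hr (by norm_num)
  let φ : ContDiffBump (0 : ℂ) := ⟨R, (R + 1) / 2, hR0, by linarith⟩
  have hts : tsupport (fun z => ((φ z : ℝ) : ℂ)) ⊆ tsupport φ :=
    closure_mono fun z hz h0 => hz (by simp [h0])
  refine ⟨fun z => ((φ z : ℝ) : ℂ), ⟨Complex.ofRealCLM.contDiff.comp φ.contDiff, ?_, ?_⟩, ?_⟩
  · exact φ.hasCompactSupport.of_isClosed_subset (isClosed_tsupport _) hts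
  · refine hts.trans ?_
    rw [φ.tsupport_eq]
    exact closedBall_subset_ball (by change (R + 1) / 2 < 1; linarith)
  · intro z hz
    have h1 : z ∈ ball (0 : ℂ) R := ball_subset_ball (le_max_left _ _) (hsub hz)
    filter_upwards [φ.eventuallyEq_one_of_mem_ball h1] with y hy
    simp [hy]

/-- `L_γ` is formally symmetric: no boundary term appears when one of the two functions has compact
support in the open disk. -/
theorem integral_diskOp_mul_conj_comm {γ : ℝ} {f g : ℂ → ℂ} (hf : f ∈ smoothInterior)
    (hg : g ∈ smoothCompact) :
    ∫ z, diskOp γ f z * conj (g z) ∂diskMeasure γ = ∫ z, f z * conj (diskOp γ g z) ∂diskMeasure γ := by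
  obtain ⟨χ, hχ, h1⟩ := exists_cutoff hg
  -- Both integrands see f only on the support of g, near which f χ and f agree.
  have h := integral_diskOp_mul_conj_comm_of_compact (γ := γ) (mul_mem_smoothCompact hf hχ) hg
  have hE : ∀ z ∈ tsupport g, (fun y => f y * χ y) =ᶠ[𝓝 z] f := fun z hz => by
    filter_upwards [h1 z hz] with y hy
    simp [hy]
  have e1 : ∀ z, diskOp γ (fun y => f y * χ y) z * conj (g z) = diskOp γ f z * conj (g z) := by
    intro z
    by_cases hz : z ∈ tsupport g
    · rw [diskOp_congr (hE z hz)]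
    · simp [image_eq_zero_of_notMem_tsupport hz]
  have e2 : ∀ z, f z * χ z * conj (diskOp γ g z) = f z * conj (diskOp γ g z) := by
    intro z
    by_cases hz : z ∈ tsupport g
    · rw [(hE z hz).eq_of_nhds]
    · rw [diskOp_eq_zero γ (notMem_tsupport_iff_eventuallyEq.1 hz)]
      simp
  simpa only [e1, e2] using h

end Green

/-! ### T as a densely defined, symmetric, nonnegative operator -/

section Realization

theorem exists_rep {γ : ℝ} {P : Submodule ℂ (ℂ → ℂ)} {hP : P ≤ smoothInterior}
    (u : (opOn γ P hP).domain) : ∃ f ∈ P, (u : DiskL2 γ) =ᵐ[diskMeasure γ] f ∧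
      opOn γ P hP u =ᵐ[diskMeasure γ] diskOp γ f := by
  have h := (opOn γ P hP).mem_graph u
  rw [opOn_graph] at h
  exact h

theorem mem_opOn_graph {γ : ℝ} {P : Submodule ℂ (ℂ → ℂ)} {hP : P ≤ smoothInterior} {f : ℂ → ℂ}
    (hf : f ∈ P) (h1 : MemLp f 2 (diskMeasure γ)) (h2 : MemLp (diskOp γ f) 2 (diskMeasure γ)) :
    (h1.toLp f, h2.toLp (diskOp γ f)) ∈ (opOn γ P hP).graph := by
  rw [opOn_graph]
  exact ⟨f, hf, h1.coeFn_toLp, h2.coeFn_toLp⟩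

theorem inner_eq_integral {γ : ℝ} {u v : DiskL2 γ} {f g : ℂ → ℂ} (hu : u =ᵐ[diskMeasure γ] f)
    (hv : v =ᵐ[diskMeasure γ] g) : inner ℂ u v = ∫ z, g z * conj (f z) ∂diskMeasure γ := by
  rw [L2.inner_def]
  refine integral_congr_ae ?_
  filter_upwards [hu, hv] with z h1 h2
  rw [h1, h2, RCLike.inner_apply]

/-- The space P is left free: P = C_c^∞ gives the symmetry of T, and P = Ċ^∞ places the preminimal
operator inside T†. -/
theorem isFormalAdjoint_opOn_compactOp {γ : ℝ} {P : Submodule ℂ (ℂ → ℂ)} {hP : P ≤ smoothInterior} :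
    (opOn γ P hP).IsFormalAdjoint (compactOp γ) := by
  intro u v
  obtain ⟨f, hf, hf1, hf2⟩ := exists_rep u
  obtain ⟨g, hg, hg1, hg2⟩ := exists_rep v
  rw [inner_eq_integral hf2 hg1]
  refine (?_ : _ = _).trans (inner_eq_integral hf1 hg2).symm
  have h := congrArg conj (integral_diskOp_mul_conj_comm (γ := γ) (hP hf) hg)
  rw [← integral_conj, ← integral_conj] at h
  simpa [mul_comm] using h

theorem compactOp_nonneg (γ : ℝ) (u : (compactOp γ).domain) :
    0 ≤ (form (compactOp γ) u u).re := by
  obtain ⟨f, hf, hf1, hf2⟩ := exists_rep u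
  rw [form]
  have h1 : inner ℂ (u : DiskL2 γ) (compactOp γ u) = ∫ z, dirichletDensity γ f f z ∂diskMeasure γ :=
    (inner_eq_integral hf1 hf2).trans (integral_diskOp_mul_conj hf hf)
  rw [h1]
  by_cases hi : Integrable (dirichletDensity γ f f) (diskMeasure γ)
  · have h2 : (∫ z, dirichletDensity γ f f z ∂diskMeasure γ).re =
        ∫ z, (dirichletDensity γ f f z).re ∂diskMeasure γ := (integral_re hi).symm
    rw [h2]
    refine integral_nonneg_of_ae ?_
    filter_upwards [ae_mem_ball γ] with z hz
    exact re_dirichletDensity_nonneg γ f hz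
  -- The Bochner integral of a nonintegrable function is 0 by convention, so integrability need not
  -- be proved here.
  · rw [integral_undef hi]; simp

/-- The weight is bounded on compact subsets of the open disk, so v is locally integrable there and
the fundamental lemma of the calculus of variations applies. -/
theorem ae_eq_zero_of_integral_smoothCompact {γ : ℝ} {v : ℂ → ℂ} (hv : MemLp v 2 (diskMeasure γ))
    (h : ∀ φ ∈ smoothCompact, ∫ z, φ z * v z ∂diskMeasure γ = 0) : v =ᵐ[diskMeasure γ] 0 := by
  have hloc : LocallyIntegrableOn v (ball 0 1) (diskMeasure γ) := by
    rw [locallyIntegrableOn_iff isOpen_ball.isLocallyClosed]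
    intro K hK hKc
    have hfin : diskMeasure γ K < ⊤ := by
      have hw : ContinuousOn (fun z => bdf z ^ γ) K := fun z hz =>
        ((contDiff_bdf (n := 1)).continuous.continuousAt.rpow_const
          (Or.inl (bdf_pos (hK hz)).ne')).continuousWithinAt
      rw [diskMeasure, withDensity_apply _ hKc.measurableSet, Measure.restrict_restrict
        hKc.measurableSet, Set.inter_eq_left.2 hK]
      exact (hw.integrableOn_compact hKc).lintegral_lt_top
    have : IsFiniteMeasure ((diskMeasure γ).restrict K) := ⟨by simpa using hfin⟩
    exact (hv.restrict K).integrable (by norm_num)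
  have h1 := isOpen_ball.ae_eq_zero_of_integral_contDiff_smul_eq_zero hloc fun g hg hg1 hg2 => by
    have hts : tsupport (fun z => ((g z : ℝ) : ℂ)) ⊆ tsupport g :=
      closure_mono fun z hz h0 => hz (by simp [h0])
    simpa using h (fun z => (g z : ℂ)) ⟨Complex.ofRealCLM.contDiff.comp hg,
      hg1.of_isClosed_subset (isClosed_tsupport _) hts, hts.trans hg2⟩
  filter_upwards [h1, ae_mem_ball γ] with z hz hzb
  exact hz hzb

theorem dense_of_inner_eq_zero {H : Type*} [NormedAddCommGroup H] [InnerProductSpace ℂ H]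
    [CompleteSpace H] {K : Submodule ℂ H} (h : ∀ v : H, (∀ u ∈ K, inner ℂ u v = 0) → v = 0) :
    Dense (K : Set H) := by
  rw [Submodule.dense_iff_topologicalClosure_eq_top, Submodule.topologicalClosure_eq_top_iff,
    Submodule.eq_bot_iff]
  exact fun v hv => h v fun u hu => (Submodule.mem_orthogonal _ _).1 hv u hu

theorem dense_domain_compactOp (γ : ℝ) : Dense ((compactOp γ).domain : Set (DiskL2 γ)) := by
  refine dense_of_inner_eq_zero fun v hv => Lp.ext ?_
  refine (ae_eq_zero_of_integral_smoothCompact (Lp.memLp v) fun φ hφ => ?_).trans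
    (Lp.coeFn_zero _ _ _).symm
  have hφ' := conj_mem_smoothCompact hφ
  have h1 := memLp_smoothCompact (γ := γ) hφ'
  have h := hv (h1.toLp _) (LinearPMap.mem_domain_of_mem_graph
    (mem_opOn_graph hφ' h1 (memLp_diskOp_smoothCompact hφ')))
  rw [inner_eq_integral h1.coeFn_toLp EventuallyEq.rfl] at h
  simpa [mul_comm] using h

end Realization

/-! ### Flat functions and their images under L_γ lie in L²_γ -/

theorem uniqueDiffOn_closedDisk : UniqueDiffOn ℝ (closedBall (0 : ℂ) 1) :=
  uniqueDiffOn_convex (convex_closedBall _ _) ⟨0, by simp [interior_closedBall]⟩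

theorem exists_unit_dist (z : ℂ) (hz : ‖z‖ ≤ 1) :
    ∃ e : ℂ, ‖e‖ = 1 ∧ ‖z - e‖ = 1 - ‖z‖ := by
  rcases eq_or_ne z 0 with rfl | h0
  · exact ⟨1, by simp, by simp⟩
  · have hn : ‖z‖ ≠ 0 := norm_ne_zero_iff.2 h0
    have hnc : (‖z‖ : ℂ) ≠ 0 := by exact_mod_cast hn
    refine ⟨z / ‖z‖, by simp [hn], ?_⟩
    have h : z - z / ‖z‖ = ((‖z‖ - 1 : ℝ) : ℂ) * (z / ‖z‖) := by
      push_cast; field_simp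
    rw [h, norm_mul, Complex.norm_real, norm_div, Complex.norm_real, norm_norm, div_self hn, mul_one,
      Real.norm_of_nonpos (by linarith)]
    ring

/-- The derivatives of a function in `Ċ^∞(𝔻)` vanish to infinite order at the boundary. -/
theorem exists_flat_bound {f : ℂ → ℂ} (hf : f ∈ smoothFlat) (N : ℕ) : ∀ n : ℕ, ∃ C : ℝ, 0 ≤ C ∧
    ∀ z ∈ closedBall (0 : ℂ) 1,
      ‖iteratedFDerivWithin ℝ n f (closedBall 0 1) z‖ ≤ C * (1 - ‖z‖) ^ N := by
  obtain ⟨hf1, hf2⟩ := hf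
  have hU := uniqueDiffOn_closedDisk
  induction N with
  | zero =>
    intro n
    have hc : ContinuousOn (iteratedFDerivWithin ℝ n f (closedBall 0 1)) (closedBall 0 1) :=
      hf1.continuousOn_iteratedFDerivWithin (by exact_mod_cast le_top) hU
    obtain ⟨C, hC⟩ := (isCompact_closedBall (0 : ℂ) 1).exists_bound_of_continuousOn hc
    exact ⟨max C 0, le_max_right _ _, fun z hz => by simpa using Or.inl (hC z hz)⟩
  | succ N ih =>
    intro n
    obtain ⟨C, hC0, hC⟩ := ih (n + 1)
    refine ⟨C, hC0, fun z hz => ?_⟩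
    have hz1 : ‖z‖ ≤ 1 := by simpa using hz
    -- The mean value inequality on the segment from a nearest boundary point e, where the n-th
    -- derivative vanishes, turns the order-N bound on derivative n + 1 into an order-(N + 1) bound
    -- on derivative n.
    obtain ⟨e, he, hze⟩ := exists_unit_dist z hz1
    have heb : e ∈ closedBall (0 : ℂ) 1 := by simp [he]
    have hseg : segment ℝ e z ⊆ closedBall 0 1 := (convex_closedBall _ _).segment_subset heb hz
    have hnorm : ∀ w ∈ segment ℝ e z, ‖z‖ ≤ ‖w‖ := by
      intro w hw
      have h1 : ‖w - e‖ ≤ ‖z - e‖ := by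
        have := norm_sub_le_of_mem_segment hw
        simpa using this
      have h2 := norm_sub_norm_le e w
      rw [norm_sub_rev] at h2
      linarith
    have hd : DifferentiableOn ℝ (iteratedFDerivWithin ℝ n f (closedBall 0 1)) (closedBall 0 1) :=
      hf1.differentiableOn_iteratedFDerivWithin (by exact_mod_cast ENat.natCast_lt_top n) hU
    have h := (convex_segment e z).norm_image_sub_le_of_norm_hasFDerivWithin_le
      (f := iteratedFDerivWithin ℝ n f (closedBall 0 1)) (C := C * (1 - ‖z‖) ^ N)
      (fun w hw => ((hd w (hseg hw)).hasFDerivWithinAt.mono hseg)) (fun w hw => ?_)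
      (left_mem_segment ℝ e z) (right_mem_segment ℝ e z)
    · rw [hf2 n e he, sub_zero, hze] at h
      rw [pow_succ, ← mul_assoc]
      exact h
    · rw [norm_fderivWithin_iteratedFDerivWithin]
      refine (hC w (hseg hw)).trans (mul_le_mul_of_nonneg_left ?_ hC0)
      have h3 : ‖w‖ ≤ 1 := by simpa using hseg hw
      exact pow_le_pow_left₀ (by linarith) (by linarith [hnorm w hw]) N

theorem bdf_le_one (z : ℂ) : bdf z ≤ 1 := by unfold bdf; nlinarith [norm_nonneg z]

theorem one_sub_norm_le_bdf {z : ℂ} (hz : z ∈ ball (0 : ℂ) 1) : 1 - ‖z‖ ≤ bdf z := by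
  have h : ‖z‖ < 1 := by simpa using hz
  unfold bdf; nlinarith [norm_nonneg z]

/-- A function that is continuous in the open disk and vanishes to infinite order at the boundary
belongs to `L²_γ` for every `γ`. -/
theorem memLp_of_flat_bound {γ : ℝ} {f : ℂ → ℂ} (hc : ContinuousOn f (ball 0 1))
    (hb : ∀ N : ℕ, ∃ C : ℝ, 0 ≤ C ∧ ∀ z ∈ ball (0 : ℂ) 1, ‖f z‖ ≤ C * (1 - ‖z‖) ^ N) :
    MemLp f 2 (diskMeasure γ) := by
  rw [memLp_two_iff_integrable_sq_norm (aestronglyMeasurable_diskMeasure hc),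
    integrable_diskMeasure_iff]
  -- With N ≥ -γ and N ≥ 0 the exponent γ + 2N is nonnegative, so x^γ ‖f‖² is bounded by C².
  obtain ⟨N, hN⟩ := exists_nat_ge (-γ)
  obtain ⟨C, hC0, hC⟩ := hb N
  have hm : ContinuousOn (fun z => bdf z ^ γ • ‖f z‖ ^ 2) (ball 0 1) := by
    have : ContinuousOn (fun z => bdf z ^ γ) (ball 0 1) := fun z hz =>
      ((contDiff_bdf (n := 1)).continuous.continuousAt.rpow_const
        (Or.inl (bdf_pos hz).ne')).continuousWithinAt
    exact this.smul (hc.norm.pow 2)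
  refine IntegrableOn.of_bound measure_ball_lt_top (hm.aestronglyMeasurable measurableSet_ball)
    (C ^ 2) ?_
  filter_upwards [ae_restrict_mem measurableSet_ball] with z hz
  have hx := bdf_pos hz
  have hz1 : ‖z‖ < 1 := by simpa using hz
  have h1 : (1 - ‖z‖) ^ N ≤ bdf z ^ N :=
    pow_le_pow_left₀ (by linarith) (one_sub_norm_le_bdf hz) N
  have h2 : ‖f z‖ ≤ C * bdf z ^ N := (hC z hz).trans (mul_le_mul_of_nonneg_left h1 hC0)
  have h3 : bdf z ^ γ * (bdf z ^ N) ^ 2 ≤ 1 := by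
    rw [← pow_mul, ← Real.rpow_natCast, ← Real.rpow_add hx]
    refine Real.rpow_le_one hx.le (bdf_le_one z) ?_
    push_cast
    have : (0 : ℝ) ≤ N := Nat.cast_nonneg N
    linarith
  have h4 : 0 ≤ bdf z ^ γ := Real.rpow_nonneg hx.le _
  rw [smul_eq_mul, Real.norm_of_nonneg (by positivity)]
  calc bdf z ^ γ * ‖f z‖ ^ 2 ≤ bdf z ^ γ * (C * bdf z ^ N) ^ 2 := by gcongr
    _ = C ^ 2 * (bdf z ^ γ * (bdf z ^ N) ^ 2) := by ring
    _ ≤ C ^ 2 * 1 := by gcongr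
    _ = C ^ 2 := mul_one _

theorem memLp_smoothFlat {γ : ℝ} {f : ℂ → ℂ} (hf : f ∈ smoothFlat) :
    MemLp f 2 (diskMeasure γ) := by
  refine memLp_of_flat_bound (smoothFlat_le hf : ContDiffOn ℝ ∞ f _).continuousOn fun N => ?_
  obtain ⟨C, hC0, hC⟩ := exists_flat_bound hf N 0
  exact ⟨C, hC0, fun z hz => by simpa using hC z (ball_subset_closedBall hz)⟩

/-- Of the 3, two come from the Laplacian (as x ≤ 1) and one from ∂_ω²; the extra 1 in the middle
coefficient is the first-order part of ∂_ω². -/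
theorem norm_diskOp_le {γ : ℝ} {f : ℂ → ℂ} {z : ℂ} (hf : ContDiffAt ℝ ∞ f z)
    (hz : z ∈ ball (0 : ℂ) 1) :
    ‖diskOp γ f z‖ ≤ 3 * ‖iteratedFDeriv ℝ 2 f z‖ + (|2 + 2 * γ| + 1) * ‖iteratedFDeriv ℝ 1 f z‖ +
      (γ + 1) ^ 2 * ‖iteratedFDeriv ℝ 0 f z‖ := by
  have hz1 : ‖z‖ ≤ 1 := by simpa using (ball_subset_closedBall hz)
  have hx0 := (bdf_pos hz).le
  have hx1 := bdf_le_one z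
  have hD : ‖iteratedFDeriv ℝ 1 f z‖ = ‖fderiv ℝ f z‖ := norm_iteratedFDeriv_one f
  have hB : ‖iteratedFDeriv ℝ 2 f z‖ = ‖fderiv ℝ (fderiv ℝ f) z‖ := by
    rw [← norm_iteratedFDeriv_fderiv (n := 1), norm_iteratedFDeriv_one]
  have hBv : ∀ v : ℂ, ‖v‖ ≤ 1 → ‖fderiv ℝ (fderiv ℝ f) z v v‖ ≤ ‖fderiv ℝ (fderiv ℝ f) z‖ := by
    intro v hv
    refine ((fderiv ℝ (fderiv ℝ f) z).le_opNorm₂ v v).trans ?_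
    have := norm_nonneg (fderiv ℝ (fderiv ℝ f) z)
    calc _ ≤ ‖fderiv ℝ (fderiv ℝ f) z‖ * 1 * 1 := by gcongr
      _ = _ := by ring
  have hDz : ‖fderiv ℝ f z z‖ ≤ ‖fderiv ℝ f z‖ :=
    ((fderiv ℝ f z).le_opNorm z).trans (mul_le_of_le_one_right (norm_nonneg _) hz1)
  have b1 := hBv 1 (by simp)
  have b2 := hBv Complex.I (by simp)
  have b3 := hBv (Complex.I * z) (by simpa using hz1)
  rw [hD, hB, norm_iteratedFDeriv_zero, diskOp_eq hf]
  refine (norm_add_le _ _).trans (add_le_add ?_ ?_)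
  · refine (norm_sub_le _ _).trans ?_
    have t1 : ‖-(bdf z : ℂ) * (fderiv ℝ (fderiv ℝ f) z 1 1 +
        fderiv ℝ (fderiv ℝ f) z Complex.I Complex.I)‖ ≤ 1 * (‖fderiv ℝ (fderiv ℝ f) z‖ +
        ‖fderiv ℝ (fderiv ℝ f) z‖) := by
      rw [norm_mul, norm_neg, Complex.norm_real, Real.norm_of_nonneg hx0]
      gcongr
      exact (norm_add_le _ _).trans (add_le_add b1 b2)
    have t2 : ‖((2 + 2 * γ : ℝ) : ℂ) * fderiv ℝ f z z‖ ≤ |2 + 2 * γ| * ‖fderiv ℝ f z‖ := by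
      rw [norm_mul, Complex.norm_real, Real.norm_eq_abs]
      gcongr
    have t3 := norm_add_le (-(bdf z : ℂ) * (fderiv ℝ (fderiv ℝ f) z 1 1 +
        fderiv ℝ (fderiv ℝ f) z Complex.I Complex.I)) (((2 + 2 * γ : ℝ) : ℂ) * fderiv ℝ f z z)
    have t4 := norm_sub_le (fderiv ℝ (fderiv ℝ f) z (Complex.I * z) (Complex.I * z)) (fderiv ℝ f z z)
    linarith
  · rw [norm_mul, Complex.norm_real, Real.norm_of_nonneg (sq_nonneg _)]

theorem memLp_diskOp_smoothFlat {γ : ℝ} {f : ℂ → ℂ} (hf : f ∈ smoothFlat) :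
    MemLp (diskOp γ f) 2 (diskMeasure γ) := by
  refine memLp_of_flat_bound (continuousOn_diskOp (smoothFlat_le hf)) fun N => ?_
  choose C hC0 hC using exists_flat_bound hf N
  refine ⟨3 * C 2 + (|2 + 2 * γ| + 1) * C 1 + (γ + 1) ^ 2 * C 0, ?_, fun z hz => ?_⟩
  · have := hC0 0
    have := hC0 1
    have := hC0 2
    positivity
  · have hz' := ball_subset_closedBall hz
    have hE : ∀ n, ‖iteratedFDeriv ℝ n f z‖ ≤ C n * (1 - ‖z‖) ^ N := by
      intro n
      have : iteratedFDerivWithin ℝ n f (closedBall 0 1) z = iteratedFDeriv ℝ n f z :=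
        iteratedFDerivWithin_eq_iteratedFDeriv uniqueDiffOn_closedDisk
          ((contDiffAt_of_mem (smoothFlat_le hf) hz).of_le (by exact_mod_cast le_top)) hz'
      rw [← this]
      exact hC n z hz'
    refine (norm_diskOp_le (contDiffAt_of_mem (smoothFlat_le hf) hz) hz).trans ?_
    calc _ ≤ 3 * (C 2 * (1 - ‖z‖) ^ N) + (|2 + 2 * γ| + 1) * (C 1 * (1 - ‖z‖) ^ N) +
          (γ + 1) ^ 2 * (C 0 * (1 - ‖z‖) ^ N) := by
          gcongr
          · exact hE 2
          · exact hE 1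
          · exact hE 0
      _ = _ := by ring

/-! ### Measure of the collar x ≤ s -/

section Collar

/-- The collar lies in an annulus of area π - π (1 - s) = π s. -/
theorem volume_collar_le {s : ℝ} (h0 : 0 ≤ s) (h1 : s ≤ 1) :
    volume ({z | bdf z ≤ s} ∩ ball (0 : ℂ) 1) ≤ ENNReal.ofReal (Real.pi * s) := by
  have hsub : {z | bdf z ≤ s} ∩ ball (0 : ℂ) 1 ⊆ ball 0 1 \ ball 0 √(1 - s) := by
    rintro z ⟨hz, hz1⟩
    refine ⟨hz1, fun h => ?_⟩
    have h2 : ‖z‖ < √(1 - s) := by simpa using h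
    have h3 : ‖z‖ ^ 2 < 1 - s := (Real.lt_sqrt (norm_nonneg z)).1 h2
    have h4 : 1 - ‖z‖ ^ 2 ≤ s := hz
    linarith
  refine (measure_mono hsub).trans ?_
  have hb : ball (0 : ℂ) √(1 - s) ⊆ ball 0 1 :=
    ball_subset_ball (Real.sqrt_le_one.2 (by linarith))
  rw [measure_sdiff hb measurableSet_ball.nullMeasurableSet measure_ball_lt_top.ne,
    Complex.volume_ball, Complex.volume_ball, ← ENNReal.ofReal_pow (Real.sqrt_nonneg _),
    Real.sq_sqrt (by linarith), ← NNReal.coe_real_pi, ← ENNReal.ofReal_coe_nnreal,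
    ← ENNReal.ofReal_pow zero_le_one, ← ENNReal.ofReal_mul (by positivity),
    ← ENNReal.ofReal_mul (by linarith), ← ENNReal.ofReal_sub _ (by
      have : (0 : ℝ) ≤ NNReal.pi := NNReal.coe_nonneg _
      nlinarith)]
  refine ENNReal.ofReal_le_ofReal (le_of_eq ?_)
  ring

/-- One power of s is the area and the other is the weight, since x^γ ≤ x ≤ s. The decay s² exactly
balances the square of the commutator size n with s = 2/n, which is why γ ≥ 1 is the threshold. -/
theorem diskMeasure_collar_le {γ s : ℝ} (hγ : 1 ≤ γ) (h0 : 0 < s) (h1 : s ≤ 1) :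
    diskMeasure γ {z | bdf z ≤ s} ≤ ENNReal.ofReal (Real.pi * s ^ 2) := by
  have hm : MeasurableSet {z : ℂ | bdf z ≤ s} :=
    measurableSet_le (contDiff_bdf (n := 1)).continuous.measurable measurable_const
  rw [diskMeasure, withDensity_apply _ hm, Measure.restrict_restrict hm]
  calc ∫⁻ z in {z | bdf z ≤ s} ∩ ball 0 1, ENNReal.ofReal (bdf z ^ γ)
      ≤ ∫⁻ _ in {z | bdf z ≤ s} ∩ ball (0 : ℂ) 1, ENNReal.ofReal s := by
        refine setLIntegral_mono measurable_const fun z hz => ENNReal.ofReal_le_ofReal ?_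
        have hx := bdf_pos hz.2
        calc bdf z ^ γ ≤ bdf z ^ (1 : ℝ) :=
              Real.rpow_le_rpow_of_exponent_ge hx (bdf_le_one z) hγ
          _ = bdf z := Real.rpow_one _
          _ ≤ s := hz.1
    _ = ENNReal.ofReal s * volume ({z | bdf z ≤ s} ∩ ball (0 : ℂ) 1) := by
        rw [setLIntegral_const]
    _ ≤ ENNReal.ofReal s * ENNReal.ofReal (Real.pi * s) := by
        gcongr
        exact volume_collar_le h0.le h1
    _ = ENNReal.ofReal (Real.pi * s ^ 2) := by
        rw [← ENNReal.ofReal_mul h0.le]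
        congr 1
        ring

theorem isFiniteMeasure_diskMeasure {γ : ℝ} (hγ : 1 ≤ γ) : IsFiniteMeasure (diskMeasure γ) := by
  refine ⟨?_⟩
  have h : (Set.univ : Set ℂ) = {z | bdf z ≤ 1} := by
    ext z; simp [bdf_le_one z]
  rw [h]
  exact (diskMeasure_collar_le hγ one_pos le_rfl).trans_lt ENNReal.ofReal_lt_top

theorem exists_norm_le_of_continuous {g : ℂ → ℂ} (hg : Continuous g) :
    ∃ C : ℝ, 0 ≤ C ∧ ∀ z ∈ ball (0 : ℂ) 1, ‖g z‖ ≤ C := by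
  obtain ⟨C, hC⟩ := (isCompact_closedBall (0 : ℂ) 1).exists_bound_of_continuousOn hg.continuousOn
  exact ⟨max C 0, le_max_right _ _, fun z hz =>
    (hC z (ball_subset_closedBall hz)).trans (le_max_left _ _)⟩

theorem integrable_continuous_mul {γ : ℝ} {g v : ℂ → ℂ} (hg : Continuous g)
    (hv : Integrable v (diskMeasure γ)) : Integrable (fun z => g z * v z) (diskMeasure γ) := by
  obtain ⟨C, -, hC⟩ := exists_norm_le_of_continuous hg
  exact hv.bdd_mul hg.aestronglyMeasurable ((ae_mem_ball γ).mono hC)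

end Collar

/-! ### Cutoffs near the boundary and their commutator with L_γ -/

section Cutoff

/-- Outside [0, 1] the derivative vanishes and on [0, 1] compactness bounds it. The conclusion
nearly reproduces the hypotheses for S', so the lemma can be iterated. -/
theorem exists_deriv_bound {S : ℝ → ℝ} (hS : ContDiff ℝ 1 S) (h0 : ∀ t < 0, S =ᶠ[𝓝 t] fun _ => S 0)
    (h1 : ∀ t > 1, S =ᶠ[𝓝 t] fun _ => S 1) :
    ∃ C : ℝ, 0 ≤ C ∧ (∀ t, |deriv S t| ≤ C) ∧ (∀ t < 0, deriv S =ᶠ[𝓝 t] fun _ => 0) ∧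
      ∀ t > 1, deriv S =ᶠ[𝓝 t] fun _ => 0 := by
  have e0 : ∀ t < 0, deriv S =ᶠ[𝓝 t] fun _ => 0 := fun t ht => by
    filter_upwards [(h0 t ht).eventuallyEq_nhds] with y hy
    rw [hy.deriv_eq, deriv_const]
  have e1 : ∀ t > 1, deriv S =ᶠ[𝓝 t] fun _ => 0 := fun t ht => by
    filter_upwards [(h1 t ht).eventuallyEq_nhds] with y hy
    rw [hy.deriv_eq, deriv_const]
  obtain ⟨C, hC⟩ := (isCompact_Icc (a := (0 : ℝ)) (b := 1)).exists_bound_of_continuousOn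
    (hS.continuous_deriv (by simp)).continuousOn
  refine ⟨max C 0, le_max_right _ _, fun t => ?_, e0, e1⟩
  rcases lt_or_ge t 0 with h | h
  · rw [(e0 t h).eq_of_nhds]; simp
  rcases lt_or_ge 1 t with h' | h'
  · rw [(e1 t h').eq_of_nhds]; simp
  · exact (hC t ⟨h, h'⟩).trans (le_max_left _ _)

theorem smoothTransition_bounds : ∃ C : ℝ, 0 ≤ C ∧
    (∀ t, |deriv Real.smoothTransition t| ≤ C ∧ |deriv (deriv Real.smoothTransition) t| ≤ C) ∧
    ∀ t > 1, deriv Real.smoothTransition t = 0 ∧ deriv (deriv Real.smoothTransition) t = 0 := by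
  have hS : ContDiff ℝ ∞ Real.smoothTransition := Real.smoothTransition.contDiff
  have hS' : ContDiff ℝ ∞ (deriv Real.smoothTransition) :=
    (contDiff_infty_iff_deriv.1 hS).2
  obtain ⟨C, hC, hb, z0, z1⟩ := exists_deriv_bound (hS.of_le (by norm_cast))
    (fun t ht => by
      filter_upwards [gt_mem_nhds ht] with y hy
      rw [Real.smoothTransition.zero_of_nonpos hy.le, Real.smoothTransition.zero_of_nonpos le_rfl])
    (fun t ht => by
      filter_upwards [lt_mem_nhds ht] with y hy
      rw [Real.smoothTransition.one_of_one_le hy.le, Real.smoothTransition.one_of_one_le le_rfl])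
  have hc : Continuous (deriv Real.smoothTransition) := hS'.continuous
  -- The values at 0 and 1 are one-sided limits of 0; they are needed to iterate
  -- `exists_deriv_bound`.
  have d0 : deriv Real.smoothTransition 0 = 0 := by
    have : (𝓝[<] (0 : ℝ)).NeBot := inferInstance
    refine tendsto_nhds_unique (hc.continuousAt.mono_left (nhdsWithin_le_nhds (s := Set.Iio 0)))
      (tendsto_const_nhds.congr' ?_)
    filter_upwards [self_mem_nhdsWithin] with y hy
    exact ((z0 y hy).eq_of_nhds).symm
  have d1 : deriv Real.smoothTransition 1 = 0 := by
    refine tendsto_nhds_unique (hc.continuousAt.mono_left (nhdsWithin_le_nhds (s := Set.Ioi 1)))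
      (tendsto_const_nhds.congr' ?_)
    filter_upwards [self_mem_nhdsWithin] with y hy
    exact ((z1 y hy).eq_of_nhds).symm
  obtain ⟨C', hC', hb', -, z1'⟩ := exists_deriv_bound (hS'.of_le (by norm_cast))
    (fun t ht => by rw [d0]; exact z0 t ht) (fun t ht => by rw [d1]; exact z1 t ht)
  exact ⟨max C C', hC.trans (le_max_left _ _), fun t => ⟨(hb t).trans (le_max_left _ _),
    (hb' t).trans (le_max_right _ _)⟩, fun t ht => ⟨(z1 t ht).eq_of_nhds, (z1' t ht).eq_of_nhds⟩⟩

/-- The cutoff function in the variable `x`, equal to `0` for `x ≤ n⁻¹` and to `1` for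
`x ≥ 2 n⁻¹`. -/
noncomputable def cutoff (n : ℝ) (t : ℝ) : ℝ := Real.smoothTransition (n * t - 1)

theorem contDiff_cutoff (n : ℝ) : ContDiff ℝ ∞ (cutoff n) :=
  Real.smoothTransition.contDiff.comp ((contDiff_const.mul contDiff_id).sub contDiff_const)

theorem hasDerivAt_affine_comp {S : ℝ → ℝ} (hS : Differentiable ℝ S) (n t : ℝ) :
    HasDerivAt (fun t => S (n * t - 1)) (n * deriv S (n * t - 1)) t := by
  have h := (hS (n * t - 1)).hasDerivAt.comp t (((hasDerivAt_id t).const_mul n).sub_const 1)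
  exact h.congr_deriv (by simp [mul_comm])

theorem cutoff_mul_mem_smoothCompact {n : ℝ} (hn : 0 < n) {g : ℂ → ℂ} (hg : ContDiff ℝ ∞ g) :
    (fun z => (cutoff n (bdf z) : ℂ) * g z) ∈ smoothCompact := by
  have hcl : IsClosed {z | n⁻¹ ≤ bdf z} :=
    isClosed_le continuous_const (contDiff_bdf (n := 1)).continuous
  have hsub : tsupport (fun z => (cutoff n (bdf z) : ℂ) * g z) ⊆ {z | n⁻¹ ≤ bdf z} := by
    refine closure_minimal (fun z hz => ?_) hcl
    by_contra h
    have h1 : bdf z < n⁻¹ := not_le.1 h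
    refine hz ?_
    have h2 : n * bdf z - 1 ≤ 0 := by
      have := mul_le_mul_of_nonneg_left h1.le hn.le
      rw [mul_inv_cancel₀ hn.ne'] at this
      linarith
    simp [cutoff, Real.smoothTransition.zero_of_nonpos h2]
  have hball : {z | n⁻¹ ≤ bdf z} ⊆ ball (0 : ℂ) 1 := by
    intro z hz
    have h1 : n⁻¹ ≤ 1 - ‖z‖ ^ 2 := hz
    have h2 : 0 < n⁻¹ := inv_pos.2 hn
    rw [mem_ball_zero_iff]
    nlinarith [norm_nonneg z]
  refine ⟨(Complex.ofRealCLM.contDiff.comp ((contDiff_cutoff n).comp contDiff_bdf)).mul hg, ?_,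
    hsub.trans hball⟩
  exact HasCompactSupport.of_support_subset_isCompact (isCompact_closedBall (0 : ℂ) 1)
    (subset_closure.trans (hsub.trans (hball.trans ball_subset_closedBall)))

/-- The commutator of `L_γ` with the cutoff is of size `n` in the collar `x ≤ 2 n⁻¹`. -/
theorem exists_commutator_bound (γ : ℝ) {g : ℂ → ℂ} (hg : ContDiff ℝ ∞ g) :
    ∃ C : ℝ, 0 ≤ C ∧ ∀ n : ℝ, 1 ≤ n → ∀ z ∈ ball (0 : ℂ) 1,
      ‖diskOp γ (fun y => (cutoff n (bdf y) : ℂ) * g y) z - (cutoff n (bdf z) : ℂ) * diskOp γ g z‖ ≤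
        {z | bdf z ≤ 2 / n}.indicator (fun _ => C * n) z := by
  obtain ⟨K, hK0, hK, hK1⟩ := smoothTransition_bounds
  obtain ⟨G, hG0, hG⟩ := exists_norm_le_of_continuous hg.continuous
  have hR : Continuous (radial g) :=
    (hg.continuous_fderiv (by simp)).clm_apply continuous_id
  obtain ⟨G', hG0', hG'⟩ := exists_norm_le_of_continuous hR
  refine ⟨(12 * K + 4 * |1 + γ| * K) * G + 4 * K * G', by positivity, fun n hn z hz => ?_⟩
  have hn0 : 0 < n := by linarith
  have hx0 := bdf_pos hz
  have hx1 := bdf_le_one z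
  have hS : ContDiff ℝ ∞ Real.smoothTransition := Real.smoothTransition.contDiff
  have hS' : ContDiff ℝ ∞ (deriv Real.smoothTransition) := (contDiff_infty_iff_deriv.1 hS).2
  rw [diskOp_comp_bdf_mul (h := cutoff n)
    (h₁ := fun t => n * deriv Real.smoothTransition (n * t - 1))
    (h₂ := fun t => n * (n * deriv (deriv Real.smoothTransition) (n * t - 1)))
    (Eventually.of_forall fun t => hasDerivAt_affine_comp (hS.differentiable (by simp)) n t)
    ((hasDerivAt_affine_comp (hS'.differentiable (by simp)) n (bdf z)).const_mul n)
    (contDiffAt_comp_bdf (contDiff_cutoff n).contDiffAt) hg.contDiffAt]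
  by_cases hA : bdf z ≤ 2 / n
  · rw [Set.indicator_of_mem (show z ∈ {z | bdf z ≤ 2 / n} from hA)]
    obtain ⟨k1, k2⟩ := hK (n * bdf z - 1)
    set d := deriv Real.smoothTransition (n * bdf z - 1)
    set d' := deriv (deriv Real.smoothTransition) (n * bdf z - 1)
    -- In the collar x n ≤ 2, so the factor x absorbs one of the two powers of n in the second
    -- derivative of the cutoff.
    have hxn : bdf z * n ≤ 2 := by rwa [le_div_iff₀ hn0] at hA
    have b1 : |-4 * bdf z * (1 - bdf z) * (n * (n * d'))| ≤ 8 * K * n := by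
      rw [show -4 * bdf z * (1 - bdf z) * (n * (n * d')) =
        -(4 * (bdf z * n) * (1 - bdf z) * n * d') by ring, abs_neg, abs_mul,
        abs_of_nonneg (by have := sub_nonneg.2 hx1; positivity)]
      have : 4 * (bdf z * n) * (1 - bdf z) * n ≤ 4 * 2 * 1 * n := by
        gcongr
        linarith
      calc _ ≤ 4 * 2 * 1 * n * K := by gcongr
        _ = _ := by ring
    have b2 : |4 * bdf z * (n * d)| ≤ 4 * K * n := by
      rw [abs_mul, abs_mul n, abs_of_nonneg (by positivity : 0 ≤ 4 * bdf z), abs_of_pos hn0]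
      calc _ ≤ 4 * 1 * (n * K) := by gcongr
        _ = _ := by ring
    have b3 : |4 * (1 + γ) * (1 - bdf z) * (n * d)| ≤ 4 * |1 + γ| * K * n := by
      rw [abs_mul, abs_mul n, abs_mul, abs_mul 4, abs_of_pos hn0,
        abs_of_nonneg (by linarith : 0 ≤ 1 - bdf z), abs_of_pos (by norm_num : (0 : ℝ) < 4)]
      calc _ ≤ 4 * |1 + γ| * 1 * (n * K) := by
            gcongr
            linarith
        _ = _ := by ring
    have b4 : |-4 * bdf z * (1 - bdf z) * (n * (n * d')) + 4 * bdf z * (n * d)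
        - 4 * (1 + γ) * (1 - bdf z) * (n * d)| ≤ (12 * K + 4 * |1 + γ| * K) * n := by
      refine (abs_sub _ _).trans ?_
      have := abs_add_le (-4 * bdf z * (1 - bdf z) * (n * (n * d'))) (4 * bdf z * (n * d))
      linarith
    rw [add_assoc, add_sub_cancel_left]
    refine (norm_add_le _ _).trans ?_
    rw [norm_mul, norm_mul, Complex.norm_real, Complex.norm_real, Real.norm_eq_abs,
      Real.norm_eq_abs]
    calc _ ≤ (12 * K + 4 * |1 + γ| * K) * n * G + 4 * K * n * G' := by
          gcongr
          · exact hG z hz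
          · exact hG' z hz
      _ = _ := by ring
  · rw [Set.indicator_of_notMem (show z ∉ {z | bdf z ≤ 2 / n} from hA)]
    -- Off the collar the cutoff is locally constant, so its derivatives vanish.
    have h1 : 1 < n * bdf z - 1 := by
      have := (div_lt_iff₀ hn0).1 (not_le.1 hA)
      linarith
    obtain ⟨k1, k2⟩ := hK1 _ h1
    simp [k1, k2]

end Cutoff

/-! ### Weak convergence of the commutators to zero -/

section Limit

/-- Each interior point eventually leaves the collar, and ‖v‖² dominates. -/
theorem tendsto_integral_collar_sq {γ : ℝ} {v : ℂ → ℂ} (hv : MemLp v 2 (diskMeasure γ)) :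
    Tendsto (fun k : ℕ => ∫ z, {z | bdf z ≤ 2 / (k + 2 : ℝ)}.indicator (fun z => ‖v z‖ ^ 2) z
      ∂diskMeasure γ) atTop (𝓝 0) := by
  have hi := (memLp_two_iff_integrable_sq_norm hv.1).1 hv
  have hm : ∀ s : ℝ, MeasurableSet {z : ℂ | bdf z ≤ s} := fun s =>
    measurableSet_le (contDiff_bdf (n := 1)).continuous.measurable measurable_const
  have h := tendsto_integral_of_dominated_convergence (μ := diskMeasure γ) (f := fun _ => (0 : ℝ))
    (F := fun k : ℕ => {z | bdf z ≤ 2 / (k + 2 : ℝ)}.indicator (fun z => ‖v z‖ ^ 2))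
    (fun z => ‖v z‖ ^ 2) (fun k => hi.1.indicator (hm _)) hi
    (fun k => Eventually.of_forall fun z => ?_) ?_
  · simpa using h
  · refine (norm_indicator_le_norm_self _ _).trans (le_of_eq ?_)
    simp
  · filter_upwards [ae_mem_ball γ] with z hz
    have h1 : Tendsto (fun k : ℕ => 2 / (k + 2 : ℝ)) atTop (𝓝 0) :=
      tendsto_const_nhds.div_atTop
        (tendsto_atTop_add_const_right _ _ tendsto_natCast_atTop_atTop)
    refine tendsto_const_nhds.congr' ?_
    filter_upwards [h1.eventually (gt_mem_nhds (bdf_pos hz))] with k hk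
    exact (Set.indicator_of_notMem (s := {z | bdf z ≤ 2 / (k + 2 : ℝ)}) (not_le.2 hk) _).symm

/-- A family bounded by `C n` in the collar `x ≤ 2 n⁻¹` tends weakly to zero in `L²_γ`, `γ ≥ 1`. -/
theorem tendsto_integral_collar {γ : ℝ} (hγ : 1 ≤ γ) {v : ℂ → ℂ} (hv : MemLp v 2 (diskMeasure γ))
    {C : ℝ} (hC : 0 ≤ C) {E : ℕ → ℂ → ℂ}
    (hE : ∀ k : ℕ, ∀ z ∈ ball (0 : ℂ) 1,
      ‖E k z‖ ≤ {z | bdf z ≤ 2 / (k + 2 : ℝ)}.indicator (fun _ => C * (k + 2)) z) :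
    Tendsto (fun k => ∫ z, E k z * v z ∂diskMeasure γ) atTop (𝓝 0) := by
  have hfin := isFiniteMeasure_diskMeasure hγ
  have hi := (memLp_two_iff_integrable_sq_norm hv.1).1 hv
  have hm : ∀ s : ℝ, MeasurableSet {z : ℂ | bdf z ≤ s} := fun s =>
    measurableSet_le (contDiff_bdf (n := 1)).continuous.measurable measurable_const
  set A : ℕ → Set ℂ := fun k => {z | bdf z ≤ 2 / (k + 2 : ℝ)} with hA
  set a : ℕ → ℝ := fun k => ∫ z, (A k).indicator (fun z => ‖v z‖ ^ 2) z ∂diskMeasure γ with ha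
  have ha0 : Tendsto a atTop (𝓝 0) := tendsto_integral_collar_sq hv
  have hapos : ∀ k, 0 ≤ a k := fun k =>
    integral_nonneg fun z => Set.indicator_nonneg (fun _ _ => sq_nonneg _) _
  -- The scale n = k + 2 keeps the collar width 2/n at most 1, as the collar bound requires.
  have hmeas : ∀ k : ℕ, (diskMeasure γ).real (A k) ≤ Real.pi * (2 / (k + 2 : ℝ)) ^ 2 := by
    intro k
    have hk : (0 : ℝ) < k + 2 := by positivity
    refine ENNReal.toReal_le_of_le_ofReal (by positivity)
      (diskMeasure_collar_le hγ (by positivity) ?_)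
    rw [div_le_one hk]
    linarith [(Nat.cast_nonneg k : (0 : ℝ) ≤ k)]
  -- Young's inequality with parameter δ stands in for Cauchy–Schwarz; the powers of k + 2 cancel
  -- against the measure of the collar, leaving 4πδ.
  have hbound : ∀ (k : ℕ) (δ : ℝ), 0 < δ →
      ‖∫ z, E k z * v z ∂diskMeasure γ‖ ≤ C * (4 * Real.pi * δ + a k / δ) := by
    intro k δ hδ
    have hk : (0 : ℝ) < k + 2 := by positivity
    have hI1 : Integrable ((A k).indicator fun _ => δ * (k + 2 : ℝ) ^ 2) (diskMeasure γ) :=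
      (integrable_const _).indicator (hm _)
    have hI2 : Integrable (fun z => (A k).indicator (fun z => ‖v z‖ ^ 2) z / δ) (diskMeasure γ) :=
      (hi.indicator (hm _)).div_const δ
    refine (norm_integral_le_of_norm_le ((hI1.add hI2).const_mul C) ?_).trans ?_
    · filter_upwards [ae_mem_ball γ] with z hz
      rw [norm_mul]
      have h1 := hE k z hz
      by_cases hzA : z ∈ A k
      · rw [Set.indicator_of_mem (show z ∈ {z | bdf z ≤ 2 / (k + 2 : ℝ)} from hzA)] at h1
        simp only [Pi.add_apply, Set.indicator_of_mem hzA]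
        calc ‖E k z‖ * ‖v z‖ ≤ C * (k + 2) * ‖v z‖ := by gcongr
          _ = C * ((k + 2) * ‖v z‖) := by ring
          _ ≤ C * (δ * (k + 2) ^ 2 + ‖v z‖ ^ 2 / δ) := by
              gcongr
              have h2 : δ * (k + 2 : ℝ) ^ 2 + ‖v z‖ ^ 2 / δ - (k + 2) * ‖v z‖ =
                  ((δ * (k + 2) - ‖v z‖ / 2) ^ 2 + 3 / 4 * ‖v z‖ ^ 2) / δ := by
                field_simp
                ring
              have h3 : 0 ≤ ((δ * (k + 2) - ‖v z‖ / 2) ^ 2 + 3 / 4 * ‖v z‖ ^ 2) / δ := by positivity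
              linarith
      · rw [Set.indicator_of_notMem (show z ∉ {z | bdf z ≤ 2 / (k + 2 : ℝ)} from hzA)] at h1
        simp only [Pi.add_apply, Set.indicator_of_notMem hzA]
        have h2 := norm_nonneg (E k z)
        have h3 : ‖E k z‖ = 0 := le_antisymm h1 h2
        simp [h3]
    · rw [integral_const_mul]
      simp only [Pi.add_apply]
      rw [integral_add hI1 hI2, integral_indicator_const _ (hm _), integral_div, smul_eq_mul]
      refine mul_le_mul_of_nonneg_left (add_le_add ?_ le_rfl) hC
      calc (diskMeasure γ).real (A k) * (δ * (k + 2 : ℝ) ^ 2)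
          ≤ Real.pi * (2 / (k + 2 : ℝ)) ^ 2 * (δ * (k + 2 : ℝ) ^ 2) := by
            gcongr
            exact hmeas k
        _ = 4 * Real.pi * δ := by field_simp; ring
  -- The choice δ = √(a k) would balance the two terms; adding 1/(k + 1) keeps δ positive when a k =
  -- 0, and a k / δ ≤ √(a k) still holds.
  have hδ : Tendsto (fun k : ℕ => √(a k) + 1 / ((k : ℝ) + 1)) atTop (𝓝 0) := by
    have h1 := ha0.sqrt
    have h2 := tendsto_one_div_add_atTop_nhds_zero_nat (𝕜 := ℝ)
    simpa using h1.add h2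
  have hlim : Tendsto (fun k : ℕ => C * (4 * Real.pi * (√(a k) + 1 / ((k : ℝ) + 1)) + √(a k)))
      atTop (𝓝 0) := by
    have h1 := ((hδ.const_mul (4 * Real.pi)).add ha0.sqrt).const_mul C
    simpa using h1
  refine squeeze_zero_norm (fun k => ?_) hlim
  have hpos : 0 < √(a k) + 1 / ((k : ℝ) + 1) := by positivity
  refine (hbound k _ hpos).trans ?_
  gcongr
  rw [div_le_iff₀ hpos]
  have h1 := Real.mul_self_sqrt (hapos k)
  have h2 : 0 ≤ √(a k) * (1 / ((k : ℝ) + 1)) := by positivity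
  nlinarith

/-- If `v ∈ L²_γ`, `γ ≥ 1`, is annihilated by `1 + L_γ` on `C_c^∞`, it is annihilated by `1 + L_γ`
on all functions that are smooth up to the boundary. -/
theorem integral_one_add_diskOp_eq_zero {γ : ℝ} (hγ : 1 ≤ γ) {v : ℂ → ℂ}
    (hv : MemLp v 2 (diskMeasure γ))
    (h : ∀ φ ∈ smoothCompact, ∫ z, (φ z + diskOp γ φ z) * v z ∂diskMeasure γ = 0)
    {g : ℂ → ℂ} (hg : ContDiff ℝ ∞ g) (hLg : Continuous (diskOp γ g)) :
    ∫ z, (g z + diskOp γ g z) * v z ∂diskMeasure γ = 0 := by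
  have hfin := isFiniteMeasure_diskMeasure hγ
  have hvi : Integrable v (diskMeasure γ) := hv.integrable (by norm_num)
  obtain ⟨C, hC0, hC⟩ := exists_commutator_bound γ hg
  have hk1 : ∀ k : ℕ, (1 : ℝ) ≤ k + 2 := fun k => by
    linarith [(Nat.cast_nonneg k : (0 : ℝ) ≤ k)]
  set χ : ℕ → ℂ → ℂ := fun k z => (cutoff (k + 2) (bdf z) : ℂ) with hχ
  set φ : ℕ → ℂ → ℂ := fun k z => χ k z * g z with hφ
  have hφc : ∀ k, φ k ∈ smoothCompact := fun k =>
    cutoff_mul_mem_smoothCompact (by linarith [hk1 k]) hg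
  set E : ℕ → ℂ → ℂ := fun k z => diskOp γ (φ k) z - χ k z * diskOp γ g z with hEdef
  have hχc : ∀ k, Continuous (χ k) := fun k =>
    Complex.continuous_ofReal.comp ((contDiff_cutoff _).continuous.comp
      (contDiff_bdf (n := 1)).continuous)
  have hLφc : ∀ k, Continuous (diskOp γ (φ k)) := fun k =>
    continuous_of_continuousOn_ball (continuousOn_diskOp (smoothCompact_le (hφc k)))
      ((tsupport_diskOp_subset γ _).trans (hφc k).2.2)
  have hEc : ∀ k, Continuous (E k) := fun k => (hLφc k).sub ((hχc k).mul hLg)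
  have hlimE : Tendsto (fun k => ∫ z, E k z * v z ∂diskMeasure γ) atTop (𝓝 0) :=
    tendsto_integral_collar hγ hv hC0 fun k z hz => hC (k + 2) (hk1 k) z hz
  set G : ℂ → ℂ := fun z => (g z + diskOp γ g z) * v z with hG
  have hGi : Integrable G (diskMeasure γ) := integrable_continuous_mul (hg.continuous.add hLg) hvi
  have hχG : ∀ k, Integrable (fun z => χ k z * G z) (diskMeasure γ) := fun k =>
    integrable_continuous_mul (hχc k) hGi
  have hlimG : Tendsto (fun k => ∫ z, χ k z * G z ∂diskMeasure γ) atTop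
      (𝓝 (∫ z, G z ∂diskMeasure γ)) := by
    refine tendsto_integral_of_dominated_convergence (fun z => ‖G z‖) (fun k => (hχG k).1) hGi.norm
      (fun k => Eventually.of_forall fun z => ?_) ?_
    · rw [norm_mul, Complex.norm_real, cutoff, Real.norm_of_nonneg (Real.smoothTransition.nonneg _)]
      exact mul_le_of_le_one_left (norm_nonneg _) (Real.smoothTransition.le_one _)
    · filter_upwards [ae_mem_ball γ] with z hz
      have hx := bdf_pos hz
      refine tendsto_const_nhds.congr' ?_
      have h1 : Tendsto (fun k : ℕ => (k + 2 : ℝ) * bdf z - 1) atTop atTop :=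
        tendsto_atTop_add_const_right _ _ (Tendsto.atTop_mul_const hx
          (tendsto_atTop_add_const_right _ _ tendsto_natCast_atTop_atTop))
      filter_upwards [h1.eventually_ge_atTop 1] with k hk
      simp [hχ, cutoff, Real.smoothTransition.one_of_one_le hk]
  -- This is the hypothesis on φ = χ g, written as (1 + L_γ)(χ g) = χ (1 + L_γ) g + E.
  have hsum : ∀ k, ∫ z, χ k z * G z ∂diskMeasure γ + ∫ z, E k z * v z ∂diskMeasure γ = 0 := by
    intro k
    rw [← integral_add (hχG k) (integrable_continuous_mul (hEc k) hvi), ← h (φ k) (hφc k)]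
    refine integral_congr_ae (Eventually.of_forall fun z => ?_)
    simp only [hG, hEdef, hφ]
    ring
  have h0 := (hlimG.add hlimE).congr hsum
  rw [add_zero] at h0
  exact (tendsto_nhds_unique h0 tendsto_const_nhds)

end Limit

/-! ### Moments of v and density of polynomials -/

section Polynomials

theorem contDiff_monomial (a b : ℕ) : ContDiff ℝ ∞ fun z : ℂ => z ^ a * conj z ^ b :=
  (contDiff_id.pow a).mul (Complex.conjCLE.contDiff.pow b)

/-- Pairing v with (1 + L_γ) z^a z̄^b expresses the (a, b) moment through the (a - 1, b - 1) moment.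
The coefficient (a + b + γ + 1)² + 1 never vanishes, so the moments die by induction on a; at a = 0
the lower-order term is absent. -/
theorem integral_monomial_eq_zero {γ : ℝ} (hγ : 1 ≤ γ) {v : ℂ → ℂ}
    (hv : MemLp v 2 (diskMeasure γ))
    (h : ∀ φ ∈ smoothCompact, ∫ z, (φ z + diskOp γ φ z) * v z ∂diskMeasure γ = 0) (a : ℕ) :
    ∀ b : ℕ, ∫ z, z ^ a * conj z ^ b * v z ∂diskMeasure γ = 0 := by
  have hfin := isFiniteMeasure_diskMeasure hγ
  have hvi : Integrable v (diskMeasure γ) := hv.integrable (by norm_num)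
  have hint : ∀ a b : ℕ, Integrable (fun z => z ^ a * conj z ^ b * v z) (diskMeasure γ) :=
    fun a b => integrable_continuous_mul (contDiff_monomial a b).continuous hvi
  have hrec : ∀ a b : ℕ, (4 * a * b : ℂ) * ∫ z, z ^ (a - 1) * conj z ^ (b - 1) * v z ∂diskMeasure γ =
      (((a + b + γ + 1) ^ 2 + 1 : ℝ) : ℂ) * ∫ z, z ^ a * conj z ^ b * v z ∂diskMeasure γ := by
    intro a b
    have hc : Continuous (diskOp γ fun z => z ^ a * conj z ^ b) := by
      rw [funext (diskOp_monomial γ a b)]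
      have := Complex.continuous_conj
      fun_prop
    have h1 := integral_one_add_diskOp_eq_zero hγ hv h (contDiff_monomial a b) hc
    rw [← integral_const_mul, ← integral_const_mul, ← sub_eq_zero,
      ← integral_sub ((hint _ _).const_mul _) ((hint _ _).const_mul _), ← neg_eq_zero,
      ← integral_neg, ← h1]
    refine integral_congr_ae (Eventually.of_forall fun z => ?_)
    simp only [diskOp_monomial]
    push_cast
    ring
  have hne : ∀ a b : ℕ, (((a + b + γ + 1) ^ 2 + 1 : ℝ) : ℂ) ≠ 0 := fun a b => by
    have : ((a + b + γ + 1) ^ 2 + 1 : ℝ) ≠ 0 := by positivity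
    exact_mod_cast this
  induction a with
  | zero =>
    intro b
    have h1 := hrec 0 b
    simp only [Nat.cast_zero, mul_zero, zero_mul] at h1
    exact (mul_eq_zero.1 h1.symm).resolve_left (by simpa using hne 0 b)
  | succ a ih =>
    intro b
    have h1 := hrec (a + 1) b
    rw [Nat.add_sub_cancel, ih (b - 1), mul_zero] at h1
    exact (mul_eq_zero.1 h1.symm).resolve_left (hne (a + 1) b)

/-- Polynomials in `z` and `z̄` are dense: an integrable function orthogonal to all monomials is
orthogonal to all continuous functions. -/
theorem integral_continuous_mul_eq_zero {γ : ℝ} {v : ℂ → ℂ} (hv : Integrable v (diskMeasure γ))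
    (h : ∀ a b : ℕ, ∫ z, z ^ a * conj z ^ b * v z ∂diskMeasure γ = 0) {φ : ℂ → ℂ}
    (hφ : Continuous φ) : ∫ z, φ z * v z ∂diskMeasure γ = 0 := by
  set K : Set ℂ := closedBall (0 : ℂ) 1 with hK
  have : CompactSpace K := isCompact_iff_compactSpace.1 (isCompact_closedBall _ _)
  set X : C(K, ℂ) := Polynomial.toContinuousMapOnAlgHom K Polynomial.X with hX
  -- Stone–Weierstrass lives on the compact disk K while the integrals are over ℂ, so each
  -- polynomial on K is carried with a continuous extension to ℂ.
  have hpoly : ∀ Q ∈ (polynomialFunctions K).starClosure, ∃ P : ℂ → ℂ, Continuous P ∧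
      (∀ z : K, P z = Q z) ∧ ∫ z, P z * v z ∂diskMeasure γ = 0 := by
    intro Q hQ
    rw [polynomialFunctions.starClosure_eq_adjoin_X, ← StarSubalgebra.mem_toSubalgebra,
      StarAlgebra.adjoin_toSubalgebra, ← Subalgebra.mem_toSubmodule, Algebra.adjoin_eq_span] at hQ
    induction hQ using Submodule.span_induction with
    | mem Q hQ =>
      rw [Set.star_singleton, Set.singleton_union, SetLike.mem_coe, Submonoid.mem_closure_pair] at hQ
      obtain ⟨a, b, rfl⟩ := hQ
      refine ⟨fun z => z ^ a * conj z ^ b, (contDiff_monomial a b).continuous, fun z => ?_, h a b⟩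
      simp
    | zero => exact ⟨0, continuous_const, fun z => rfl, by simp⟩
    | add Q₁ Q₂ _ _ h1 h2 =>
      obtain ⟨P₁, c1, e1, i1⟩ := h1
      obtain ⟨P₂, c2, e2, i2⟩ := h2
      refine ⟨fun z => P₁ z + P₂ z, c1.add c2, fun z => by simp [e1, e2], ?_⟩
      simp only [add_mul]
      rw [integral_add (integrable_continuous_mul c1 hv) (integrable_continuous_mul c2 hv), i1, i2,
        add_zero]
    | smul c Q _ h1 =>
      obtain ⟨P, c1, e1, i1⟩ := h1
      refine ⟨fun z => c * P z, continuous_const.mul c1, fun z => by simp [e1], ?_⟩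
      simp only [mul_assoc]
      rw [integral_const_mul, i1, mul_zero]
  rw [← norm_le_zero_iff]
  refine le_of_forall_pos_le_add fun ε hε => ?_
  rw [zero_add]
  set M : ℝ := ∫ z, ‖v z‖ ∂diskMeasure γ with hM
  have hM0 : 0 ≤ M := integral_nonneg fun _ => norm_nonneg _
  set F : C(K, ℂ) := ⟨fun z => φ z, hφ.comp continuous_subtype_val⟩ with hF
  have hmem : F ∈ closure ((polynomialFunctions K).starClosure : Set C(K, ℂ)) := by
    rw [← StarSubalgebra.topologicalClosure_coe, polynomialFunctions.starClosure_topologicalClosure]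
    trivial
  -- The 1 guards against M = 0.
  have hδ : 0 < ε / (M + 1) := by positivity
  obtain ⟨Q, hQ, hd⟩ := Metric.mem_closure_iff.1 hmem _ hδ
  obtain ⟨P, hP, hPQ, hPi⟩ := hpoly Q hQ
  have h1 : ∫ z, φ z * v z ∂diskMeasure γ = ∫ z, (φ z - P z) * v z ∂diskMeasure γ := by
    simp only [sub_mul]
    rw [integral_sub (integrable_continuous_mul hφ hv) (integrable_continuous_mul hP hv), hPi,
      sub_zero]
  rw [h1]
  refine (norm_integral_le_of_norm_le (hv.norm.const_mul (ε / (M + 1))) ?_).trans ?_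
  · filter_upwards [ae_mem_ball γ] with z hz
    rw [norm_mul]
    gcongr
    have h2 := (ContinuousMap.dist_apply_le_dist (f := F) (g := Q)
      ⟨z, ball_subset_closedBall hz⟩).trans hd.le
    rw [← hPQ, dist_eq_norm] at h2
    exact h2
  · rw [integral_const_mul, div_mul_eq_mul_div, div_le_iff₀ (by positivity)]
    nlinarith

theorem ae_eq_zero_of_one_add_diskOp_of_one_le {γ : ℝ} (hγ : 1 ≤ γ) {v : ℂ → ℂ}
    (hv : MemLp v 2 (diskMeasure γ))
    (h : ∀ φ ∈ smoothCompact, ∫ z, (φ z + diskOp γ φ z) * v z ∂diskMeasure γ = 0) :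
    v =ᵐ[diskMeasure γ] 0 := by
  have hfin := isFiniteMeasure_diskMeasure hγ
  have hvi : Integrable v (diskMeasure γ) := hv.integrable (by norm_num)
  exact ae_eq_zero_of_integral_smoothCompact hv fun φ hφ =>
    integral_continuous_mul_eq_zero hvi (integral_monomial_eq_zero hγ hv h) hφ.1.continuous

end Polynomials

/-! ### Reduction of γ ≤ -1 to γ ≥ 1 -/

section Conjugation

theorem diskMeasure_absolutelyContinuous (γ δ : ℝ) : diskMeasure γ ≪ diskMeasure δ := by
  refine Measure.ae_le_iff_absolutelyContinuous.1 fun s hs => ?_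
  exact (ae_diskMeasure_iff γ _).2 ((ae_diskMeasure_iff δ _).1 hs)

/-- Multiplication by `x^γ` is an isometry from `L²_γ` to `L²_{-γ}`. -/
theorem memLp_rpow_mul {γ : ℝ} {v : ℂ → ℂ} (hv : MemLp v 2 (diskMeasure γ)) :
    MemLp (fun z => ((bdf z ^ γ : ℝ) : ℂ) * v z) 2 (diskMeasure (-γ)) := by
  have hm : AEStronglyMeasurable (fun z => ((bdf z ^ γ : ℝ) : ℂ) * v z) (diskMeasure (-γ)) := by
    refine AEStronglyMeasurable.mul ?_ (hv.1.mono_ac (diskMeasure_absolutelyContinuous _ _))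
    have : Measurable fun z : ℂ => ((bdf z ^ γ : ℝ) : ℂ) := by unfold bdf; fun_prop
    exact this.aestronglyMeasurable
  rw [memLp_two_iff_integrable_sq_norm hm, integrable_diskMeasure_iff]
  have h := (memLp_two_iff_integrable_sq_norm hv.1).1 hv
  rw [integrable_diskMeasure_iff] at h
  refine h.congr_fun (fun z hz => ?_) measurableSet_ball
  have hx := Real.rpow_pos_of_pos (bdf_pos hz) γ
  simp only [norm_mul, Complex.norm_real, Real.norm_of_nonneg hx.le, smul_eq_mul,
    Real.rpow_neg (bdf_pos hz).le]
  field_simp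

/-- For γ ≤ -1 the function x^γ v lies in L²_{-γ}. Testing it with (1 + L_{-γ}) ψ is the same as
testing v with (1 + L_γ) φ, where φ = x^{-γ} ψ is again in C_c^∞, so the case -γ ≥ 1 applies. -/
theorem ae_eq_zero_of_one_add_diskOp {γ : ℝ} (hγ : 1 ≤ |γ|) {v : ℂ → ℂ}
    (hv : MemLp v 2 (diskMeasure γ))
    (h : ∀ φ ∈ smoothCompact, ∫ z, (φ z + diskOp γ φ z) * v z ∂diskMeasure γ = 0) :
    v =ᵐ[diskMeasure γ] 0 := by
  rcases le_abs.1 hγ with h1 | h1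
  · exact ae_eq_zero_of_one_add_diskOp_of_one_le h1 hv h
  · have h2 := ae_eq_zero_of_one_add_diskOp_of_one_le h1 (memLp_rpow_mul hv) fun ψ hψ => by
      rw [← h _ (mul_mem_smoothCompact (rpow_mem_smoothInterior (-γ)) hψ), integral_diskMeasure,
        integral_diskMeasure]
      refine setIntegral_congr_fun measurableSet_ball fun z hz => ?_
      have hx := Real.rpow_pos_of_pos (bdf_pos hz) γ
      have hne : ((bdf z ^ γ : ℝ) : ℂ) ≠ 0 := by exact_mod_cast hx.ne'
      simp only [diskOp_rpow_mul hz hψ.1.contDiffAt, Real.rpow_neg (bdf_pos hz).le,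
        Complex.real_smul]
      push_cast
      field_simp
    have h3 := (diskMeasure_absolutelyContinuous γ (-γ)).ae_eq h2
    filter_upwards [h3, ae_mem_ball γ] with z hz hzb
    have hx := Real.rpow_pos_of_pos (bdf_pos hzb) γ
    have hne : ((bdf z ^ γ : ℝ) : ℂ) ≠ 0 := by exact_mod_cast hx.ne'
    exact (mul_eq_zero.1 hz).resolve_left hne

end Conjugation

/-! ### Self-adjointness, Friedrichs extension and uniqueness -/

section SelfAdjointness

variable {γ : ℝ}

theorem graph_adjoint_compactOp (hγ : 1 ≤ |γ|) :
    (compactOp γ).adjoint.graph = (compactOp γ).graph.topologicalClosure := by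
  refine LinearPMap.graph_adjoint_eq_topologicalClosure (dense_domain_compactOp γ)
    isFormalAdjoint_opOn_compactOp (compactOp_nonneg γ) fun v hv => Lp.ext ?_
  have hvm := Lp.memLp v
  -- The vanishing lemma uses a bilinear pairing, so it is applied to the complex conjugate of v.
  have h0 := ae_eq_zero_of_one_add_diskOp hγ hvm.star fun φ hφ => by
    have h1 := memLp_smoothCompact (γ := γ) hφ
    have h2 := memLp_diskOp_smoothCompact (γ := γ) hφ
    obtain ⟨u, hu1, hu2⟩ := (compactOp γ).mem_graph_iff.1 (mem_opOn_graph hφ h1 h2)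
    have h3 := hv u
    dsimp only at hu1 hu2
    rw [hu1, hu2, ← MemLp.toLp_add h1 h2, inner_eq_integral (MemLp.coeFn_toLp _) EventuallyEq.rfl]
      at h3
    have h4 := congrArg conj h3
    rw [← integral_conj] at h4
    simpa [mul_comm] using h4
  filter_upwards [h0, Lp.coeFn_zero ℂ 2 (diskMeasure γ)] with z hz hz0
  rw [hz0]
  simpa using hz

theorem smoothCompact_le_smoothFlat : smoothCompact ≤ smoothFlat := by
  intro f hf
  refine ⟨hf.1.contDiffOn, fun n z hz => ?_⟩
  have hzs : z ∉ tsupport f := fun h => by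
    have := hf.2.2 h
    rw [mem_ball_zero_iff, hz] at this
    exact lt_irrefl _ this
  have h0 : f =ᶠ[𝓝[closedBall 0 1] z] 0 :=
    (notMem_tsupport_iff_eventuallyEq.1 hzs).filter_mono nhdsWithin_le_nhds
  rw [h0.iteratedFDerivWithin_eq (notMem_tsupport_iff_eventuallyEq.1 hzs).eq_of_nhds]
  have h : iteratedFDerivWithin ℝ n (0 : ℂ → ℂ) (closedBall 0 1) = 0 :=
    iteratedFDerivWithin_fun_zero
  rw [h, Pi.zero_apply]

theorem compactOp_le_preminimal : compactOp γ ≤ preminimal γ := by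
  refine LinearPMap.le_of_le_graph ?_
  rw [compactOp, preminimal, opOn_graph, opOn_graph]
  rintro p ⟨f, hf, h⟩
  exact ⟨f, smoothCompact_le_smoothFlat hf, h⟩

/-- The closed operator T† extends the preminimal operator; this holds for every real γ. -/
theorem preminimal_isClosable : (preminimal γ).IsClosable :=
  (LinearPMap.adjoint_isClosed (dense_domain_compactOp γ)).isClosable.leIsClosable
    ((isFormalAdjoint_opOn_compactOp.symm).le_adjoint (dense_domain_compactOp γ))

/-- The closure of T lies in the minimal operator, which lies in the closed operator T†; the two
ends coincide. -/
theorem minimal_eq_adjoint (hγ : 1 ≤ |γ|) : minimal γ = (compactOp γ).adjoint := by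
  have hd := dense_domain_compactOp γ
  have hle : preminimal γ ≤ (compactOp γ).adjoint :=
    (isFormalAdjoint_opOn_compactOp.symm).le_adjoint hd
  refine LinearPMap.eq_of_eq_graph ?_
  rw [minimal, ← preminimal_isClosable.graph_closure_eq_closure_graph]
  refine le_antisymm (Submodule.topologicalClosure_minimal _ (LinearPMap.le_graph_of_le hle)
    (LinearPMap.adjoint_isClosed hd)) ?_
  rw [graph_adjoint_compactOp hγ]
  exact Submodule.topologicalClosure_mono (LinearPMap.le_graph_of_le compactOp_le_preminimal)

theorem isSelfAdjoint_minimal (hγ : 1 ≤ |γ|) : IsSelfAdjoint (minimal γ) := by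
  rw [LinearPMap.isSelfAdjoint_def, minimal_eq_adjoint hγ]
  exact LinearPMap.adjoint_adjoint_eq_of_graph_adjoint (dense_domain_compactOp γ)
    isFormalAdjoint_opOn_compactOp (graph_adjoint_compactOp hγ)

theorem isFriedrichsExtension_minimal (hγ : 1 ≤ |γ|) :
    IsFriedrichsExtension (compactOp γ) (minimal γ) :=
  isFriedrichsExtension_of_graph_adjoint (dense_domain_compactOp γ) isFormalAdjoint_opOn_compactOp
    (compactOp_nonneg γ) (graph_adjoint_compactOp hγ)
    ((congrArg LinearPMap.graph (minimal_eq_adjoint hγ)).trans (graph_adjoint_compactOp hγ))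

/-- A self-adjoint operator is closed, so T extends the minimal operator; taking adjoints reverses
the inclusion between two self-adjoint operators. -/
theorem eq_minimal_of_isSelfAdjoint (hγ : 1 ≤ |γ|) {T : DiskL2 γ →ₗ.[ℂ] DiskL2 γ}
    (hT : IsSelfAdjoint T) (h : preminimal γ ≤ T) : T = minimal γ := by
  have hmin := isSelfAdjoint_minimal hγ
  have h1 : minimal γ ≤ T := by
    refine LinearPMap.le_of_le_graph ?_
    rw [minimal, ← preminimal_isClosable.graph_closure_eq_closure_graph]
    exact Submodule.topologicalClosure_minimal _ (LinearPMap.le_graph_of_le h) hT.isClosed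
  have h2 := LinearPMap.adjoint_le_adjoint hmin.dense_domain h1
  rw [LinearPMap.isSelfAdjoint_def.1 hT, LinearPMap.isSelfAdjoint_def.1 hmin] at h2
  exact le_antisymm h2 h1

end SelfAdjointness

end DiskOperator

theorem theorem2p2 (γ : ℝ) (hγ : 1 ≤ |γ|) :
    (∀ f ∈ DiskOperator.smoothFlat,
      MeasureTheory.MemLp f 2 (DiskOperator.diskMeasure γ) ∧
      MeasureTheory.MemLp (DiskOperator.diskOp γ f) 2 (DiskOperator.diskMeasure γ)) ∧
    (DiskOperator.preminimal γ).IsClosable ∧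
    IsSelfAdjoint (DiskOperator.minimal γ) ∧
    DiskOperator.IsFriedrichsExtension (DiskOperator.compactOp γ) (DiskOperator.minimal γ) ∧
    (∀ T : DiskOperator.DiskL2 γ →ₗ.[ℂ] DiskOperator.DiskL2 γ,
      (IsSelfAdjoint T ∧ DiskOperator.preminimal γ ≤ T) ↔ T = DiskOperator.minimal γ) := by
  refine ⟨fun f hf => ⟨DiskOperator.memLp_smoothFlat hf, DiskOperator.memLp_diskOp_smoothFlat hf⟩,
    DiskOperator.preminimal_isClosable, DiskOperator.isSelfAdjoint_minimal hγ,
    DiskOperator.isFriedrichsExtension_minimal hγ, fun T => ⟨fun h => ?_, ?_⟩⟩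
  · exact DiskOperator.eq_minimal_of_isSelfAdjoint hγ h.1 h.2
  · rintro rfl
    exact ⟨DiskOperator.isSelfAdjoint_minimal hγ, LinearPMap.le_closure _⟩
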